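/- **Notation.** Let $t\in\mathbb C$ and $\mathbb Z_2=\{1,-1\}$. *Partitions.* For $k,l\in\mathbb N=\{0,1,2,\dots\}$ let $P(k,l)$ be the set of partitions of $\{1,\dots,k,1',\dots,l'\}$ (lower row $1,\dots,k$, upper row $1',\dots,l'$), and let $P_{even}(k,l)$ be the set of those all of whose blocks have even size. For $p\in P(k,l)$ and $q\in P(l,m)$ let $q\star p\in P(k,m)$ be the partition obtained by stacking $q$ on top of $p$, and $l(q,p)$ the number of connected components of the stacked diagram contained in the middle row. Let $\otimes$ denote horizontal concatenation. *Coloured partitions.* A $\mathbb Z_2$-coloured partition $(p,z)$ of size $(k,l)$ is a $p\in P(k,l)$ with a label in $\mathbb Z_2$ on each of the $k+l$ vertices. Two of them are equivalent if they have the same underlying partition and on each block their labels differ by a common factor in $\mathbb Z_2$. Let $P_{\mathbb Z_2}(k,l)$ be the set of equivalence classes. Let $(p,z)$ be of size $(k,l)$ and $(q,w)$ of size $(l,m)$. They are compatible if the products of the two labels at the middle vertices are constant on the set of middle vertices in each block of $q$. In that case $(q,w)\star(p,z)$ has underlying partition $q\star p$; its lower labels are those of $p$, and its upper labels are those of $q$,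 each multiplied by the product of labels at any middle vertex in the same block of $q$, if there is one. Two classes are compatible if they have compatible representatives, and these are then used to compute $\star$, which does not depend on their choice. *Categories.* $\underline{\mathrm{Rep}}_0(H_t)$ has objects $[k]$, $k\in\mathbb N$, and $\mathrm{Hom}([k],[l])=\mathbb C P_{even}(k,l)$, with bilinear composition determined by $q\circ p=t^{\,l(q,p)}\,q\star p$. $\mathrm{Par}(\mathbb Z_2,t)$ has objects $[\tilde k]$, $k\in\mathbb N$, and $\mathrm{Hom}([\tilde k],[\tilde l])=\mathbb C P_{\mathbb Z_2}(k,l)$, with bilinear composition determined by $(q,w)\circ(p,z)=t^{\,l(q,p)}\,(q,w)\star(p,z)$ for compatible classes and $(q,w)\circ(p,z)=0$ otherwise. In both categories the tensor product is addition on objects and the bilinear extension of horizontal concatenation on morphisms. These are strict $\mathbb C$-linear monoidal categories. $\mathcal C^{Kar}$ denotes the Karoubian envelope of $\mathcal C$, that is, the idempotent completion of its additive envelope, with the induced monoidal structure. A partition is regarded as a coloured partition with all labels equal to $1$. Let $$e'=\tfrac12\left(\mathrm{id}_{[\tilde 1]}-\tau\right)\in\mathrm{End}([\tilde 1]),$$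 where $\tau$ is the class of the partition $\{\{1,1'\}\}$ with label $-1$ on $1$ and $1$ on $1'$. Then $e'$ is idempotent. A tensor functor is a $\mathbb C$-linear strong monoidal functor. It is strict if it preserves the unit object and tensor products of objects on the nose, with identities as structure morphisms. **Theorem.** For every $t\in\mathbb C$ there is a well-defined strict $\mathbb C$-linear tensor functor $$\Omega_0:\underline{\mathrm{Rep}}_0(H_t)\to\mathrm{Par}(\mathbb Z_2,2t)^{Kar}$$ with $\Omega_0([k])=([\tilde k],(e')^{\otimes k})$ for all $k\in\mathbb N$, and such that for all $k,l\in\mathbb N$ and every $f\in P_{even}(k,l)$ with $s$ blocks, of sizes $m_1,\dots,m_s$, $$\Omega_0(f)=2^{\frac{(\sum_{i=1}^s m_i)-2s}{2}}\;(e')^{\otimes l}\circ f\circ(e')^{\otimes k}.$$ -/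

import Mathlib

open CategoryTheory

namespace Interpolation

/-! ### Partitions -/

/-- A partition of `{1, …, k, 1', …, l'}`, given by the equivalence relation of lying in the same
block. The vertices `1, …, k` of the lower row are `Sum.inl i`, the vertices `1', …, l'` of the
upper row are `Sum.inr j`. -/
abbrev Partition (k l : ℕ) := Setoid (Fin k ⊕ Fin l)

/-- The vertices of the lower of two stacked diagrams, inside the stacking. -/
def low {k l m : ℕ} : Fin k ⊕ Fin l → Fin k ⊕ Fin l ⊕ Fin m := Sum.map id Sum.inl

/-- The vertices of the upper of two stacked diagrams, inside the stacking. -/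
def high {k l m : ℕ} : Fin l ⊕ Fin m → Fin k ⊕ Fin l ⊕ Fin m := Sum.inr

/-- The bottom and top rows of a stacking of two diagrams. -/
def outer {k l m : ℕ} : Fin k ⊕ Fin m → Fin k ⊕ Fin l ⊕ Fin m := Sum.map id Sum.inr

/-- Two vertices of the stacking joined by a block of the lower or of the upper partition. -/
inductive StackRel {k l m : ℕ} (p : Partition k l) (q : Partition l m) :
    Fin k ⊕ Fin l ⊕ Fin m → Fin k ⊕ Fin l ⊕ Fin m → Prop
  | low {u v : Fin k ⊕ Fin l} : p u v → StackRel p q (low u) (low v)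
  | high {u v : Fin l ⊕ Fin m} : q u v → StackRel p q (high u) (high v)

namespace Partition

variable {k l m k' l' : ℕ}

/-- The connected components of `q` stacked on top of `p`. -/
@[reducible] def stack (p : Partition k l) (q : Partition l m) : Setoid (Fin k ⊕ Fin l ⊕ Fin m) :=
  Relation.EqvGen.setoid (StackRel p q)

/-- Vertical concatenation `q p`: the partition of the outer rows induced by `q` stacked on top
of `p`. -/
@[reducible] def vcomp (p : Partition k l) (q : Partition l m) : Partition k m :=
  (stack p q).comap outer

/-- The number `l(q, p)` of loops: connected components of `q` stacked on top of `p` that lie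
entirely in the middle row. -/
noncomputable def loops (p : Partition k l) (q : Partition l m) : ℕ :=
  Nat.card {c : Quotient (stack p q) //
    ∀ u, Quotient.mk (stack p q) u = c → ∃ j : Fin l, u = Sum.inr (Sum.inl j)}

/-- The identity partition `{{1, 1'}, …, {n, n'}}`. -/
@[reducible] def idn (n : ℕ) : Partition n n := Setoid.ker (Sum.elim id id)

/-- The vertices of a horizontal concatenation, sorted into those of the left and of the right
diagram. -/
def split (k l k' l' : ℕ) :
    Fin (k + k') ⊕ Fin (l + l') ≃ (Fin k ⊕ Fin l) ⊕ (Fin k' ⊕ Fin l') :=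
  (Equiv.sumCongr finSumFinEquiv.symm finSumFinEquiv.symm).trans (Equiv.sumSumSumComm _ _ _ _)

/-- Horizontal concatenation `p ⊗ q`. -/
@[reducible] def tens (p : Partition k l) (q : Partition k' l') : Partition (k + k') (l + l') where
  r u v := Sum.LiftRel p q (split k l k' l' u) (split k l k' l' v)
  iseqv := by
    refine ⟨fun u => ?_, fun {u v} h => ?_, fun {u v w} h h' => ?_⟩
    · cases split k l k' l' u
      · exact Sum.LiftRel.inl (p.refl _)
      · exact Sum.LiftRel.inr (q.refl _)
    · revert h
      generalize split k l k' l' u = a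
      generalize split k l k' l' v = b
      rintro (h | h)
      · exact Sum.LiftRel.inl (p.symm h)
      · exact Sum.LiftRel.inr (q.symm h)
    · revert h h'
      generalize split k l k' l' u = a
      generalize split k l k' l' v = b
      generalize split k l k' l' w = c
      rintro (h | h) (h' | h')
      · exact Sum.LiftRel.inl (p.trans h h')
      · exact Sum.LiftRel.inr (q.trans h h')

/-- A partition is even if each of its blocks has an even number of vertices. -/
def IsEven (p : Partition k l) : Prop := ∀ B ∈ p.classes, Even B.ncard

end Partition

/-! ### `ℤ₂`-coloured partitions -/

/-- A partition together with a label in `ℤ₂ = {1, -1}` for each vertex. -/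
structure ColouredDiagram (k l : ℕ) where
  part : Partition k l
  label : Fin k ⊕ Fin l → ℤˣ

namespace ColouredDiagram

variable {k l m k' l' : ℕ}

/-- Equivalence of coloured diagrams: the partitions agree, and on each block the labels differ by
a common factor. -/
instance setoid (k l : ℕ) : Setoid (ColouredDiagram k l) where
  r x y := x.part = y.part ∧
    ∃ c : Fin k ⊕ Fin l → ℤˣ, (∀ u v, x.part u v → c u = c v) ∧ ∀ u, y.label u = c u * x.label u
  iseqv := by
    refine ⟨fun x => ⟨rfl, 1, by simp, by simp⟩, ?_, ?_⟩
    · rintro x y ⟨h, c, hc, hl⟩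
      refine ⟨h.symm, c⁻¹, fun u v huv => ?_, fun u => ?_⟩
      · simp [hc u v (h ▸ huv)]
      · simp only [hl, Pi.inv_apply, inv_mul_cancel_left]
    · rintro x y z ⟨h, c, hc, hl⟩ ⟨h', c', hc', hl'⟩
      refine ⟨h.trans h', c' * c, fun u v huv => ?_, fun u => ?_⟩
      · simp [hc u v huv, hc' u v (h ▸ huv)]
      · simp [hl, hl', mul_assoc]

/-- `y` can be stacked on top of `x`: the products of the two labels of the middle vertices agree
for vertices in the same block of `y`. -/
def Compatible (x : ColouredDiagram k l) (y : ColouredDiagram l m) : Prop :=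
  ∀ i j : Fin l, y.part (Sum.inl i) (Sum.inl j) →
    x.label (Sum.inr i) * y.label (Sum.inl i) = x.label (Sum.inr j) * y.label (Sum.inl j)

open Classical in
/-- The label (a product of two labels) of a middle vertex that is connected to the vertex `v` in
`y`, and `1` if there is no such vertex. -/
noncomputable def middleLabel (x : ColouredDiagram k l) (y : ColouredDiagram l m)
    (v : Fin l ⊕ Fin m) : ℤˣ :=
  if h : ∃ i : Fin l, y.part (Sum.inl i) v then
    x.label (Sum.inr h.choose) * y.label (Sum.inl h.choose) else 1

/-- Vertical concatenation: `y` stacked on top of `x`, for compatible `x` and `y`. -/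
noncomputable def vcomp (x : ColouredDiagram k l) (y : ColouredDiagram l m) :
    ColouredDiagram k m where
  part := x.part.vcomp y.part
  label := Sum.elim (fun i => x.label (Sum.inl i))
    (fun j => y.label (Sum.inr j) * middleLabel x y (Sum.inr j))

/-- Horizontal concatenation. -/
def tens (x : ColouredDiagram k l) (y : ColouredDiagram k' l') :
    ColouredDiagram (k + k') (l + l') where
  part := x.part.tens y.part
  label u := Sum.elim x.label y.label (Partition.split k l k' l' u)

end ColouredDiagram

/-- `ℤ₂`-coloured partitions up to equivalence: the set `P_{ℤ₂}(k, l)`. -/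
def CPart (k l : ℕ) := Quotient (ColouredDiagram.setoid k l)

namespace CPart

variable {k l m n k' l' m' : ℕ}

/-- The equivalence class of a coloured diagram. -/
def mk (x : ColouredDiagram k l) : CPart k l := Quotient.mk _ x

/-- A partition as a coloured partition, with all labels `1`. -/
def ofPartition (p : Partition k l) : CPart k l := mk ⟨p, 1⟩

/-- The underlying partition. -/
@[reducible] def part (X : CPart k l) : Partition k l :=
  Quotient.lift (s := ColouredDiagram.setoid k l) ColouredDiagram.part (fun _ _ h => h.1) X

/-- Two classes are compatible if they have compatible representatives. -/
def Compatible (X : CPart k l) (Y : CPart l m) : Prop :=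
  ∃ x : ColouredDiagram k l × ColouredDiagram l m,
    mk x.1 = X ∧ mk x.2 = Y ∧ x.1.Compatible x.2

/-- The number of loops of `Y` stacked on top of `X`. -/
noncomputable def loops (X : CPart k l) (Y : CPart l m) : ℕ := X.part.loops Y.part

open Classical in
/-- Vertical concatenation of classes, computed on compatible representatives; `none` if the
classes are not compatible. -/
noncomputable def vcomp (X : CPart k l) (Y : CPart l m) : Option (CPart k m) :=
  if h : Compatible X Y then some (mk (h.choose.1.vcomp h.choose.2)) else none

/-! #### Evaluation on states

A coloured partition is determined by a relation between states of its rows, and vertical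
concatenation corresponds to a matrix product. This yields the laws of the category. -/

/-- Possible states of a vertex. -/
abbrev S := ℤˣ × Bool

/-- A state of all vertices is admissible if it is constant, up to labels, on blocks. -/
def Adm (x : ColouredDiagram k l) (f : Fin k ⊕ Fin l → S) : Prop :=
  ∀ u v, x.part u v → x.label u * (f u).1 = x.label v * (f v).1 ∧ (f u).2 = (f v).2

theorem adm_of_equiv {x y : ColouredDiagram k l} (h : x ≈ y) (f : Fin k ⊕ Fin l → S)
    (hx : Adm x f) : Adm y f := by
  obtain ⟨hp, c, hc, hl⟩ := h
  intro u v huv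
  rw [← hp] at huv
  have := hx u v huv
  rw [hl, hl, hc u v huv, mul_assoc, mul_assoc, this.1]
  exact ⟨rfl, this.2⟩

theorem equiv_of_adm {x y : ColouredDiagram k l} (h : ∀ f, Adm x f ↔ Adm y f) : x ≈ y := by
  classical
  have aux : ∀ {x y : ColouredDiagram k l}, (∀ f, Adm x f → Adm y f) →
      (∀ u v, y.part u v → x.part u v) ∧
      (∀ u v, y.part u v → y.label u * x.label u = y.label v * x.label v) := by
    intro x y h
    refine ⟨fun u v huv => ?_, fun u v huv => ?_⟩
    · have h1 : Adm x (fun w => (x.label w, decide (x.part u w))) := by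
        intro a b hab
        refine ⟨by simp, ?_⟩
        simp only [decide_eq_decide]
        exact ⟨fun h => x.part.trans h hab, fun h => x.part.trans h (x.part.symm hab)⟩
      have h2 := (h _ h1 u v huv).2
      simp only [decide_eq_decide] at h2
      exact h2.1 (x.part.refl u)
    · have h1 : Adm x (fun w => (x.label w, true)) := by
        intro a b hab
        simp
      exact (h _ h1 u v huv).1
  have h1 := aux (fun f => (h f).1)
  have h2 := aux (fun f => (h f).2)
  have hp : x.part = y.part := Setoid.ext fun u v => ⟨h2.1 u v, h1.1 u v⟩
  refine ⟨hp, fun u => y.label u * x.label u, fun u v huv => h1.2 u v (hp ▸ huv), fun u => ?_⟩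
  rw [mul_assoc, Int.units_mul_self, mul_one]

/-- Admissibility of a state for a coloured partition. -/
def Sat (X : CPart k l) (f : Fin k ⊕ Fin l → S) : Prop :=
  Quotient.lift (fun x => Adm x f)
    (fun _ _ h => propext ⟨adm_of_equiv h f, adm_of_equiv (Setoid.symm h) f⟩) X

theorem sat_mk (x : ColouredDiagram k l) (f : Fin k ⊕ Fin l → S) : Sat (mk x) f ↔ Adm x f := Iff.rfl

theorem ext_sat {X Y : CPart k l} (h : ∀ f, Sat X f ↔ Sat Y f) : X = Y := by
  induction X using Quotient.inductionOn with | _ x =>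
  induction Y using Quotient.inductionOn with | _ y =>
  exact Quotient.sound (equiv_of_adm h)

theorem exists_sat (X : CPart k l) : ∃ f, Sat X f := by
  induction X using Quotient.inductionOn with | _ x =>
  exact ⟨fun u => (x.label u, true), fun u v _ => by simp⟩

/-- The state of the stacking of two diagrams with given states of the three rows. -/
def three (i : Fin k → S) (j : Fin l → S) (m' : Fin m → S) : Fin k ⊕ Fin l ⊕ Fin m → S :=
  Sum.elim i (Sum.elim j m')

theorem three_low (i : Fin k → S) (j : Fin l → S) (e : Fin m → S) (u : Fin k ⊕ Fin l) :
    three i j e (low u) = Sum.elim i j u := by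
  cases u <;> rfl

theorem three_high (i : Fin k → S) (j : Fin l → S) (e : Fin m → S) (u : Fin l ⊕ Fin m) :
    three i j e (high u) = Sum.elim j e u := rfl

theorem three_outer (i : Fin k → S) (j : Fin l → S) (e : Fin m → S) (u : Fin k ⊕ Fin m) :
    three i j e (outer u) = Sum.elim i e u := by
  cases u <;> rfl

/-- A labelling of the stacking that restricts to the labels of compatible diagrams. -/
noncomputable def joint (x : ColouredDiagram k l) (y : ColouredDiagram l m) :
    Fin k ⊕ Fin l ⊕ Fin m → ℤˣ :=
  Sum.elim (fun i => x.label (Sum.inl i)) (Sum.elim (fun i => x.label (Sum.inr i))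
    (fun j => y.label (Sum.inr j) * x.middleLabel y (Sum.inr j)))

theorem joint_low (x : ColouredDiagram k l) (y : ColouredDiagram l m) (u) :
    joint x y (low u) = x.label u := by
  cases u <;> rfl

theorem joint_outer (x : ColouredDiagram k l) (y : ColouredDiagram l m) (u) :
    joint x y (outer u) = (x.vcomp y).label u := by
  cases u <;> rfl

theorem middleLabel_congr {x : ColouredDiagram k l} {y : ColouredDiagram l m}
    (h : x.Compatible y) (u v) (huv : y.part u v) : x.middleLabel y u = x.middleLabel y v := by
  have key : ∀ (u v) (huv : y.part u v) (hu : ∃ i : Fin l, y.part (Sum.inl i) u),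
      x.middleLabel y u = x.middleLabel y v := by
    intro u v huv hu
    have hv : ∃ i : Fin l, y.part (Sum.inl i) v := hu.imp fun i hi => y.part.trans hi huv
    rw [ColouredDiagram.middleLabel, ColouredDiagram.middleLabel, dif_pos hu, dif_pos hv]
    exact h _ _ (y.part.trans (y.part.trans hu.choose_spec huv) (y.part.symm hv.choose_spec))
  by_cases hu : ∃ i : Fin l, y.part (Sum.inl i) u
  · exact key u v huv hu
  by_cases hv : ∃ i : Fin l, y.part (Sum.inl i) v
  · exact (key v u (y.part.symm huv) hv).symm
  rw [ColouredDiagram.middleLabel, ColouredDiagram.middleLabel, dif_neg hu, dif_neg hv]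

theorem joint_high {x : ColouredDiagram k l} {y : ColouredDiagram l m} (h : x.Compatible y) (u) :
    joint x y (high u) = y.label u * x.middleLabel y u := by
  cases u with
  | inl i =>
    have hi : ∃ i' : Fin l, y.part (Sum.inl i') (Sum.inl i) := ⟨i, y.part.refl _⟩
    have := h _ _ hi.choose_spec
    rw [ColouredDiagram.middleLabel, dif_pos hi, this, mul_left_comm, Int.units_mul_self, mul_one]
    rfl
  | inr j => rfl

/-- A state is admissible for two stacked compatible diagrams if and only if it is constant on
components, up to the joint labelling. -/
theorem adm_stack {x : ColouredDiagram k l} {y : ColouredDiagram l m} (h : x.Compatible y)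
    (i : Fin k → S) (j : Fin l → S) (e : Fin m → S) :
    (Adm x (Sum.elim i j) ∧ Adm y (Sum.elim j e)) ↔
      ∀ u v, x.part.stack y.part u v →
        joint x y u * (three i j e u).1 = joint x y v * (three i j e v).1 ∧
          (three i j e u).2 = (three i j e v).2 := by
  constructor
  · rintro ⟨h1, h2⟩ u v huv
    induction huv with
    | rel u v huv =>
      cases huv with
      | low huv =>
        simp only [three_low, joint_low]
        exact h1 _ _ huv
      | high huv =>
        simp only [three_high, joint_high h]
        have := h2 _ _ huv
        rw [middleLabel_congr h _ _ huv, mul_right_comm, this.1, mul_right_comm]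
        exact ⟨rfl, this.2⟩
    | refl u => simp
    | symm u v _ ih => exact ⟨ih.1.symm, ih.2.symm⟩
    | trans u v w _ _ ih ih' => exact ⟨ih.1.trans ih'.1, ih.2.trans ih'.2⟩
  · intro H
    refine ⟨fun u v huv => ?_, fun u v huv => ?_⟩
    · have := H _ _ (Relation.EqvGen.rel _ _ (StackRel.low huv))
      simpa only [three_low, joint_low] using this
    · have := H _ _ (Relation.EqvGen.rel _ _ (StackRel.high huv))
      simp only [three_high, joint_high h] at this
      refine ⟨?_, this.2⟩
      have h3 := this.1
      rw [middleLabel_congr h _ _ huv, mul_right_comm, mul_right_comm (y.label v)] at h3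
      exact mul_right_cancel h3

theorem compatible_of_adm {x : ColouredDiagram k l} {y : ColouredDiagram l m}
    (i : Fin k → S) (j : Fin l → S) (e : Fin m → S)
    (h1 : Adm x (Sum.elim i j)) (h2 : Adm y (Sum.elim j e)) : Compatible (mk x) (mk y) := by
  have aux : ∀ {k l : ℕ} {x : ColouredDiagram k l} {f : Fin k ⊕ Fin l → S}, Adm x f →
      mk ⟨x.part, fun u => (f u).1⟩ = mk x := by
    intro k l x f hf
    refine Quotient.sound ⟨rfl, fun u => x.label u * (f u).1, fun u v huv => (hf u v huv).1, ?_⟩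
    intro u
    rw [mul_assoc, Int.units_mul_self, mul_one]
  refine ⟨(_, _), aux h1, aux h2, fun a b _ => ?_⟩
  simp

open Classical in
/-- The number of admissible states of the middle row, for compatible diagrams. -/
theorem card_middle {x : ColouredDiagram k l} {y : ColouredDiagram l m} (h : x.Compatible y)
    (i : Fin k → S) (e : Fin m → S) :
    Nat.card {j : Fin l → S // Adm x (Sum.elim i j) ∧ Adm y (Sum.elim j e)} =
      if Adm (x.vcomp y) (Sum.elim i e) then 4 ^ x.part.loops y.part else 0 := by
  set W := x.part.stack y.part with hW
  set c := joint x y with hc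
  split_ifs with hA
  · -- a function on components that is prescribed on the components meeting the outer rows
    have ex : ∃ g0 : Quotient W → S, ∀ u : Fin k ⊕ Fin m,
        g0 (Quotient.mk W (outer u)) = (c (outer u) * (Sum.elim i e u).1, (Sum.elim i e u).2) := by
      refine ⟨fun q => if hq : ∃ u : Fin k ⊕ Fin m, Quotient.mk W (outer u) = q then
        (c (outer hq.choose) * (Sum.elim i e hq.choose).1, (Sum.elim i e hq.choose).2)
        else (1, true), fun u => ?_⟩
      have hq : ∃ u' : Fin k ⊕ Fin m, Quotient.mk W (outer u') = Quotient.mk W (outer u) :=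
        ⟨u, rfl⟩
      refine (dif_pos hq).trans ?_
      have := hA _ _ (Quotient.exact (s := W) hq.choose_spec)
      rw [← joint_outer, ← joint_outer] at this
      exact Prod.ext this.1 this.2
    obtain ⟨g0, hg0⟩ := ex
    let closed := {q : Quotient W // ∀ u, Quotient.mk W u = q → ∃ j : Fin l, u = Sum.inr (Sum.inl j)}
    let P : Quotient W → Prop :=
      fun q => ∀ u, Quotient.mk W u = q → ∃ j : Fin l, u = Sum.inr (Sum.inl j)
    have hout : ∀ u : Fin k ⊕ Fin m, ¬ P (Quotient.mk W (outer u)) := by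
      intro u hu
      obtain ⟨j, hj⟩ := hu _ rfl
      cases u <;> simp [outer] at hj
    let mid : Fin l → Fin k ⊕ Fin l ⊕ Fin m := fun a => Sum.inr (Sum.inl a)
    let G : (closed → S) → Quotient W → S := fun t q => if hq : P q then t ⟨q, hq⟩ else g0 q
    let J : (closed → S) → Fin l → S := fun t a =>
      (c (mid a) * (G t (Quotient.mk W (mid a))).1, (G t (Quotient.mk W (mid a))).2)
    have hJ : ∀ t v, three i (J t) e v =
        (c v * (G t (Quotient.mk W v)).1, (G t (Quotient.mk W v)).2) := by
      intro t v
      have h0 : ∀ u : Fin k ⊕ Fin m, three i (J t) e (outer u) =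
          (c (outer u) * (G t (Quotient.mk W (outer u))).1,
            (G t (Quotient.mk W (outer u))).2) := by
        intro u
        have : G t (Quotient.mk W (outer u)) = _ := (dif_neg (hout u)).trans (hg0 u)
        rw [this, three_outer, ← mul_assoc, Int.units_mul_self, one_mul]
      rcases v with v | v | v
      · exact h0 (Sum.inl v)
      · rfl
      · exact h0 (Sum.inr v)
    have hmem : ∀ t, Adm x (Sum.elim i (J t)) ∧ Adm y (Sum.elim (J t) e) := by
      intro t
      rw [adm_stack h]
      intro u v huv
      rw [hJ, hJ, Quotient.sound (s := W) huv, ← hc]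
      simp only [← mul_assoc, Int.units_mul_self, and_self]
    let F : (closed → S) → {j : Fin l → S // Adm x (Sum.elim i j) ∧ Adm y (Sum.elim j e)} :=
      fun t => ⟨J t, hmem t⟩
    have hF : Function.Bijective F := by
      constructor
      · intro t t' htt
        funext q
        obtain ⟨q, hq⟩ := q
        induction q using Quotient.inductionOn with | _ v =>
        obtain ⟨a, rfl⟩ := hq v rfl
        have h1 : J t a = J t' a := congrFun (congrArg Subtype.val htt) a
        have h2 : G t (Quotient.mk W (mid a)) = G t' (Quotient.mk W (mid a)) := by
          have := Prod.ext_iff.1 h1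
          exact Prod.ext (mul_left_cancel this.1) this.2
        have h3 : ∀ t, G t (Quotient.mk W (mid a)) = t ⟨_, hq⟩ := fun t => dif_pos hq
        rwa [h3, h3] at h2
      · rintro ⟨j, hj⟩
        have hj' := hj
        rw [adm_stack h, ← hc] at hj'
        let val : Fin k ⊕ Fin l ⊕ Fin m → S := fun v =>
          (c v * (three i j e v).1, (three i j e v).2)
        have hval : ∀ u v, W u v → val u = val v := fun u v huv =>
          Prod.ext (hj' u v huv).1 (hj' u v huv).2
        let g : Quotient W → S := Quotient.lift val hval
        refine ⟨fun q => g q.1, Subtype.ext (funext fun a => ?_)⟩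
        have hG : G (fun q : closed => g q.1) (Quotient.mk W (mid a)) = val (mid a) := by
          by_cases hq : P (Quotient.mk W (mid a))
          · exact dif_pos hq
          · have h1 : G (fun q : closed => g q.1) (Quotient.mk W (mid a)) = _ := dif_neg hq
            rw [h1]
            obtain ⟨u, hu, hu'⟩ : ∃ u, Quotient.mk W u = Quotient.mk W (mid a) ∧
                ¬ ∃ j : Fin l, u = Sum.inr (Sum.inl j) := by
              by_contra! hcon
              exact hq hcon
            obtain ⟨w, rfl⟩ : ∃ w, u = outer w := by
              rcases u with u | u | u
              · exact ⟨Sum.inl u, rfl⟩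
              · exact absurd ⟨u, rfl⟩ hu'
              · exact ⟨Sum.inr u, rfl⟩
            rw [← hu, hg0, ← three_outer i j e]
            exact hval _ _ (Quotient.exact hu)
        change (_, _) = j a
        rw [hG]
        simp only [val, ← mul_assoc, Int.units_mul_self, one_mul]
        rfl
    rw [← Nat.card_congr (Equiv.ofBijective F hF), Nat.card_fun]
    have h4 : Nat.card S = 4 := by rw [Nat.card_eq_fintype_card]; rfl
    rw [h4]
    rfl
  · rw [Nat.card_eq_zero]
    left
    refine ⟨fun ⟨j, hj⟩ => hA ?_⟩
    rw [adm_stack h, ← hc] at hj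
    intro u v huv
    have := hj _ _ huv
    simpa only [three_outer, hc, joint_outer] using this

/-- Up to a power of the parameter, either a coloured partition or zero. -/
abbrev Term (k l : ℕ) := Option (ℕ × CPart k l)

/-- The product of terms. -/
noncomputable def mulT (A : Term k l) (B : Term l m) : Term k m :=
  A.bind fun a => B.bind fun b => (vcomp a.2 b.2).map fun Z => (a.1 + b.1 + loops a.2 b.2, Z)

open Classical in
/-- The matrix of a term. -/
noncomputable def mat (A : Term k l) : Matrix (Fin k → S) (Fin l → S) ℕ :=
  fun i j => A.elim 0 fun a => if Sat a.2 (Sum.elim i j) then 4 ^ a.1 else 0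

theorem mat_injective : Function.Injective (mat (k := k) (l := l)) := by
  classical
  have h0 : ∀ a : ℕ × CPart k l, mat none ≠ mat (some a) := by
    intro a h
    obtain ⟨f, hf⟩ := exists_sat a.2
    have := congrFun (congrFun h (fun i => f (Sum.inl i))) (fun i => f (Sum.inr i))
    have hf : Sat a.2 (Sum.elim (fun i => f (Sum.inl i)) (fun i => f (Sum.inr i))) := by
      rwa [show Sum.elim (fun i => f (Sum.inl i)) (fun i => f (Sum.inr i)) = f from
        Sum.elim_comp_inl_inr f]
    simp only [mat, Option.elim] at this
    rw [if_pos hf] at this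
    exact absurd this (by positivity)
  rintro (_ | a) (_ | b) h
  · rfl
  · exact absurd h (h0 b)
  · exact absurd h.symm (h0 a)
  · have key : ∀ f, (if Sat a.2 f then 4 ^ a.1 else 0) = if Sat b.2 f then 4 ^ b.1 else 0 := by
      intro f
      have := congrFun (congrFun h (fun i => f (Sum.inl i))) (fun i => f (Sum.inr i))
      have hf : Sum.elim (fun i => f (Sum.inl i)) (fun i => f (Sum.inr i)) = f :=
        Sum.elim_comp_inl_inr f
      simpa only [mat, Option.elim, hf] using this
    have h2 : a.2 = b.2 := by
      refine ext_sat fun f => ?_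
      have := key f
      have h4 : ∀ n : ℕ, 4 ^ n ≠ 0 := fun n => by positivity
      split_ifs at this with h1 h2 h2
      · exact iff_of_true h1 h2
      · exact absurd this (h4 _)
      · exact absurd this.symm (h4 _)
      · exact iff_of_false h1 h2
    obtain ⟨f, hf⟩ := exists_sat a.2
    have h1 := key f
    rw [if_pos hf, if_pos (h2 ▸ hf)] at h1
    have h1 := Nat.pow_right_injective (le_refl 4 |>.trans' (by norm_num)) h1
    rw [Prod.ext h1 h2]

open Classical in
theorem sum_sat (X : CPart k l) (Y : CPart l m) (i : Fin k → S) (e : Fin m → S) :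
    (∑ j : Fin l → S, (if Sat X (Sum.elim i j) then 1 else 0) *
      (if Sat Y (Sum.elim j e) then 1 else 0)) =
      mat ((vcomp X Y).map fun Z => (loops X Y, Z)) i e := by
  rw [vcomp]
  split_ifs with h
  · have h1 := h.choose_spec.1
    have h2 := h.choose_spec.2.1
    have h3 := card_middle h.choose_spec.2.2 i e
    rw [Nat.card_eq_fintype_card, Fintype.card_subtype, Finset.card_filter] at h3
    have h4 : loops X Y = h.choose.1.part.loops h.choose.2.part :=
      congrArg₂ loops h1.symm h2.symm
    simp only [mat, Option.elim, Option.map, h4, sat_mk]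
    refine Eq.trans (Finset.sum_congr rfl fun j _ => ?_) h3
    rw [← sat_mk, ← sat_mk, h1, h2]
    split_ifs <;> simp_all
  · simp only [mat, Option.elim, Option.map]
    refine Finset.sum_eq_zero fun j _ => ?_
    induction X using Quotient.inductionOn with | _ x =>
    induction Y using Quotient.inductionOn with | _ y =>
    by_contra hne
    have h1 : Sat (mk x) (Sum.elim i j) := by
      by_contra h'
      exact hne (by rw [if_neg (show ¬ Sat (Quotient.mk _ x) _ from h'), zero_mul])
    have h2 : Sat (mk y) (Sum.elim j e) := by
      by_contra h'
      exact hne (by rw [if_neg (show ¬ Sat (Quotient.mk _ y) _ from h'), mul_zero])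
    exact h (compatible_of_adm i j e h1 h2)

theorem mat_mulT (A : Term k l) (B : Term l m) : mat (mulT A B) = mat A * mat B := by
  classical
  ext i e
  rw [Matrix.mul_apply]
  rcases A with _ | ⟨a, X⟩
  · simp [mulT, mat]
  rcases B with _ | ⟨b, Y⟩
  · simp [mulT, mat]
  have h : ∑ j, mat (some (a, X)) i j * mat (some (b, Y)) j e =
      4 ^ a * 4 ^ b * ∑ j : Fin l → S, (if Sat X (Sum.elim i j) then 1 else 0) *
      (if Sat Y (Sum.elim j e) then 1 else 0) := by
    rw [Finset.mul_sum]
    refine Finset.sum_congr rfl fun j _ => ?_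
    simp only [mat, Option.elim]
    split_ifs <;> simp
  rw [h, sum_sat]
  simp only [mulT, Option.bind_some]
  rcases vcomp X Y with _ | Z
  · simp [mat]
  · simp only [mat, Option.map_some, Option.elim]
    split_ifs
    · rw [pow_add, pow_add]
    · simp

theorem mulT_assoc (A : Term k l) (B : Term l m) (C : Term m n) :
    mulT (mulT A B) C = mulT A (mulT B C) :=
  mat_injective (by simp only [mat_mulT, Matrix.mul_assoc])

theorem sat_idn (i j : Fin n → S) :
    Sat (ofPartition (Partition.idn n)) (Sum.elim i j) ↔ i = j := by
  constructor
  · intro h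
    funext a
    have := h (Sum.inl a) (Sum.inr a) rfl
    exact Prod.ext (by simpa using this.1) this.2
  · rintro rfl u v huv
    have : Sum.elim i i u = Sum.elim i i v := by
      have h : ∀ w, Sum.elim i i w = i (Sum.elim id id w) := by rintro (w | w) <;> rfl
      rw [h, h]
      exact congrArg i huv
    simp [this]

/-- The term of the identity. -/
def one (n : ℕ) : Term n n := some (0, ofPartition (Partition.idn n))

theorem mat_one : mat (one n) = 1 := by
  classical
  ext i j
  simp only [mat, one, Option.elim, sat_idn, Matrix.one_apply, pow_zero]

theorem one_mulT (A : Term k l) : mulT (one k) A = A :=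
  mat_injective (by rw [mat_mulT, mat_one, Matrix.one_mul])

theorem mulT_one (A : Term k l) : mulT A (one l) = A :=
  mat_injective (by rw [mat_mulT, mat_one, Matrix.mul_one])

/-! #### Horizontal concatenation -/

/-- Vertices of the left diagram in a horizontal concatenation. -/
def left (k l k' l' : ℕ) : Fin k ⊕ Fin l → Fin (k + k') ⊕ Fin (l + l') :=
  Sum.map (Fin.castAdd k') (Fin.castAdd l')

/-- Vertices of the right diagram in a horizontal concatenation. -/
def right (k l k' l' : ℕ) : Fin k' ⊕ Fin l' → Fin (k + k') ⊕ Fin (l + l') :=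
  Sum.map (Fin.natAdd k) (Fin.natAdd l)

theorem split_left (u) : Partition.split k l k' l' (left k l k' l' u) = Sum.inl u := by
  rcases u with u | u <;> simp [Partition.split, left]

theorem split_right (u) : Partition.split k l k' l' (right k l k' l' u) = Sum.inr u := by
  rcases u with u | u <;> simp [Partition.split, right]

theorem left_or_right (w) : (∃ u, w = left k l k' l' u) ∨ ∃ u, w = right k l k' l' u := by
  rcases h : Partition.split k l k' l' w with u | u
  · exact Or.inl ⟨u, (Partition.split k l k' l').injective (by rw [h, split_left])⟩
  · exact Or.inr ⟨u, (Partition.split k l k' l').injective (by rw [h, split_right])⟩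

theorem adm_tens (x : ColouredDiagram k l) (y : ColouredDiagram k' l') (f) :
    Adm (x.tens y) f ↔
      Adm x (fun u => f (left k l k' l' u)) ∧ Adm y (fun u => f (right k l k' l' u)) := by
  constructor
  · intro h
    refine ⟨fun u v huv => ?_, fun u v huv => ?_⟩
    · have := h (left k l k' l' u) (left k l k' l' v) (by
        change Sum.LiftRel _ _ _ _
        rw [split_left, split_left]
        exact Sum.LiftRel.inl huv)
      simpa only [ColouredDiagram.tens, split_left, Sum.elim_inl] using this
    · have := h (right k l k' l' u) (right k l k' l' v) (by
        change Sum.LiftRel _ _ _ _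
        rw [split_right, split_right]
        exact Sum.LiftRel.inr huv)
      simpa only [ColouredDiagram.tens, split_right, Sum.elim_inr] using this
  · rintro ⟨h1, h2⟩ w w' hw
    change Sum.LiftRel _ _ _ _ at hw
    rcases left_or_right w with ⟨u, rfl⟩ | ⟨u, rfl⟩ <;>
      rcases left_or_right w' with ⟨v, rfl⟩ | ⟨v, rfl⟩ <;>
      simp only [split_left, split_right, Sum.liftRel_inl_inl, Sum.liftRel_inr_inr,
        Sum.not_liftRel_inl_inr, Sum.not_liftRel_inr_inl] at hw <;>
      simp only [ColouredDiagram.tens, split_left, split_right, Sum.elim_inl, Sum.elim_inr]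
    · exact h1 u v hw
    · exact h2 u v hw

/-- Horizontal concatenation of classes. -/
def tens (X : CPart k l) (Y : CPart k' l') : CPart (k + k') (l + l') :=
  Quotient.map₂ ColouredDiagram.tens (fun x x' hx y y' hy => equiv_of_adm fun f => by
    have e : ∀ {k l : ℕ} {x y : ColouredDiagram k l}, x ≈ y → ∀ f, Adm x f ↔ Adm y f :=
      fun h f => ⟨adm_of_equiv h f, adm_of_equiv (Setoid.symm h) f⟩
    rw [adm_tens, adm_tens, e hx, e hy]) X Y

theorem sat_tens (X : CPart k l) (Y : CPart k' l') (i : Fin (k + k') → S) (j : Fin (l + l') → S) :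
    Sat (tens X Y) (Sum.elim i j) ↔
      Sat X (Sum.elim (fun a => i (Fin.castAdd k' a)) (fun a => j (Fin.castAdd l' a))) ∧
      Sat Y (Sum.elim (fun a => i (Fin.natAdd k a)) (fun a => j (Fin.natAdd l a))) := by
  induction X using Quotient.inductionOn with | _ x =>
  induction Y using Quotient.inductionOn with | _ y =>
  have h1 : (fun u => Sum.elim i j (left k l k' l' u)) =
      Sum.elim (fun a => i (Fin.castAdd k' a)) (fun a => j (Fin.castAdd l' a)) := by
    funext u; rcases u with u | u <;> rfl
  have h2 : (fun u => Sum.elim i j (right k l k' l' u)) =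
      Sum.elim (fun a => i (Fin.natAdd k a)) (fun a => j (Fin.natAdd l a)) := by
    funext u; rcases u with u | u <;> rfl
  rw [← h1, ← h2]
  exact adm_tens x y _

/-- Horizontal concatenation of terms. -/
def tensT (A : Term k l) (B : Term k' l') : Term (k + k') (l + l') :=
  A.bind fun a => B.map fun b => (a.1 + b.1, tens a.2 b.2)

theorem mat_tensT (A : Term k l) (B : Term k' l') (i : Fin (k + k') → S) (j : Fin (l + l') → S) :
    mat (tensT A B) i j =
      mat A (fun a => i (Fin.castAdd k' a)) (fun a => j (Fin.castAdd l' a)) *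
      mat B (fun a => i (Fin.natAdd k a)) (fun a => j (Fin.natAdd l a)) := by
  classical
  rcases A with _ | ⟨a, X⟩
  · simp [tensT, mat]
  rcases B with _ | ⟨b, Y⟩
  · simp [tensT, mat]
  simp only [tensT, mat, Option.bind_some, Option.map_some, Option.elim, sat_tens]
  split_ifs <;> simp_all [pow_add]

theorem mulT_tensT (A : Term k l) (A' : Term k' l') (B : Term l m) (B' : Term l' m') :
    mulT (tensT A A') (tensT B B') = tensT (mulT A B) (mulT A' B') := by
  apply mat_injective
  ext i e
  rw [mat_mulT, mat_tensT, mat_mulT, mat_mulT, Matrix.mul_apply, Matrix.mul_apply,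
    Matrix.mul_apply, Finset.sum_mul_sum, ← Fintype.sum_prod_type']
  refine (Fintype.sum_equiv (Fin.appendEquiv l l' (α := S)) _ _ fun p => ?_).symm
  obtain ⟨p, p'⟩ := p
  simp only [mat_tensT, Fin.appendEquiv, Equiv.coe_fn_mk, Fin.append_left, Fin.append_right]
  ring

theorem tensT_one : tensT (one k) (one l) = one (k + l) := by
  classical
  apply mat_injective
  ext i j
  rw [mat_tensT, mat_one, mat_one, mat_one]
  simp only [Matrix.one_apply]
  have : i = j ↔ (fun a => i (Fin.castAdd l a)) = (fun a => j (Fin.castAdd l a)) ∧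
      (fun a => i (Fin.natAdd k a)) = (fun a => j (Fin.natAdd k a)) := by
    constructor
    · rintro rfl; exact ⟨rfl, rfl⟩
    · rintro ⟨h1, h2⟩
      funext a
      refine Fin.addCases (fun a => congrFun h1 a) (fun a => congrFun h2 a) a
  split_ifs <;> simp_all

/-- Change of the sizes of a term along equalities. -/
def castT {k l k' l' : ℕ} (hk : k = k') (hl : l = l') (A : Term k l) : Term k' l' := hk ▸ hl ▸ A

theorem mat_castT {k l k' l' : ℕ} (hk : k = k') (hl : l = l') (A : Term k l) (i j) :
    mat (castT hk hl A) i j = mat A (fun a => i (Fin.cast hk a)) (fun a => j (Fin.cast hl a)) := by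
  subst hk hl
  rfl

theorem tensT_assoc {k₁ l₁ k₂ l₂ k₃ l₃ : ℕ} (A : Term k₁ l₁) (B : Term k₂ l₂) (C : Term k₃ l₃) :
    castT (add_assoc _ _ _) (add_assoc _ _ _) (tensT (tensT A B) C) = tensT A (tensT B C) := by
  apply mat_injective
  ext i j
  simp only [mat_castT, mat_tensT, mul_assoc]
  congr 4 <;> funext a <;> congr 1 <;> ext <;> simp [add_assoc]

theorem one_tensT (A : Term k l) : castT (zero_add _) (zero_add _) (tensT (one 0) A) = A := by
  apply mat_injective
  ext i j
  simp only [mat_castT, mat_tensT, mat_one]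
  rw [Subsingleton.elim (fun a => i _) (fun a => j _), Matrix.one_apply_eq, one_mul]
  congr 1 <;> funext a <;> congr 1 <;> ext <;> simp

theorem tensT_one' (A : Term k l) : castT (add_zero _) (add_zero _) (tensT A (one 0)) = A := by
  apply mat_injective
  ext i j
  simp only [mat_castT, mat_tensT, mat_one]
  rw [Subsingleton.elim (fun a => i (Fin.cast _ (Fin.natAdd _ a))) (fun a => j _),
    Matrix.one_apply_eq, mul_one]
  rfl

/-! #### Linear combinations -/

/-- The composite `t ^ l(Y, X) Y X` of two coloured partitions, which is zero if they are not
compatible. -/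
noncomputable def compBasis (t : ℂ) (X : CPart k l) (Y : CPart l m) : CPart k m →₀ ℂ :=
  (vcomp X Y).elim 0 fun Z => Finsupp.single Z (t ^ loops X Y)

/-- Bilinear extension of the composition of coloured partitions. -/
noncomputable def compL (t : ℂ) :
    (CPart k l →₀ ℂ) →ₗ[ℂ] (CPart l m →₀ ℂ) →ₗ[ℂ] (CPart k m →₀ ℂ) :=
  Finsupp.linearCombination ℂ fun X => Finsupp.linearCombination ℂ fun Y => compBasis t X Y

/-- Bilinear extension of the horizontal concatenation of coloured partitions. -/
noncomputable def tensL :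
    (CPart k l →₀ ℂ) →ₗ[ℂ] (CPart k' l' →₀ ℂ) →ₗ[ℂ] (CPart (k + k') (l + l') →₀ ℂ) :=
  Finsupp.linearCombination ℂ fun X => Finsupp.linearCombination ℂ fun Y =>
    Finsupp.single (tens X Y) 1

/-- The linear combination given by a term. -/
noncomputable def ev (t : ℂ) (A : Term k l) : CPart k l →₀ ℂ :=
  A.elim 0 fun a => Finsupp.single a.2 (t ^ a.1)

theorem compL_single (t : ℂ) (X : CPart k l) (Y : CPart l m) (a b : ℂ) :
    compL t (Finsupp.single X a) (Finsupp.single Y b) = (a * b) • compBasis t X Y := by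
  simp [compL, Finsupp.linearCombination_single, smul_smul]

theorem tensL_single (X : CPart k l) (Y : CPart k' l') (a b : ℂ) :
    tensL (Finsupp.single X a) (Finsupp.single Y b) = Finsupp.single (tens X Y) (a * b) := by
  simp [tensL, Finsupp.linearCombination_single]

theorem compL_ev (t : ℂ) (A : Term k l) (B : Term l m) :
    compL t (ev t A) (ev t B) = ev t (mulT A B) := by
  rcases A with _ | ⟨a, X⟩
  · simp [ev, mulT]
  rcases B with _ | ⟨b, Y⟩
  · simp [ev, mulT]
  simp only [ev, Option.elim, mulT, Option.bind_some, compL_single, compBasis]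
  rcases vcomp X Y with _ | Z
  · simp
  · simp [pow_add]

theorem tensL_ev (t : ℂ) (A : Term k l) (B : Term k' l') :
    tensL (ev t A) (ev t B) = ev t (tensT A B) := by
  rcases A with _ | ⟨a, X⟩
  · simp [ev, tensT]
  rcases B with _ | ⟨b, Y⟩
  · simp [ev, tensT]
  simp [ev, tensT, tensL_single, pow_add]

theorem induction_ev (t : ℂ) {P : (CPart k l →₀ ℂ) → Prop} (f : CPart k l →₀ ℂ) (h0 : P 0)
    (hadd : ∀ f g, P f → P g → P (f + g)) (hsmul : ∀ (c : ℂ) f, P f → P (c • f))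
    (hev : ∀ A : Term k l, P (ev t A)) : P f := by
  induction f using Finsupp.induction_linear with
  | zero => exact h0
  | add f g hf hg => exact hadd f g hf hg
  | single X c =>
    have : Finsupp.single X c = c • ev t (some (0, X)) := by simp [ev]
    rw [this]
    exact hsmul _ _ (hev _)

theorem compL_assoc (t : ℂ) (f : CPart k l →₀ ℂ) (g : CPart l m →₀ ℂ) (h : CPart m n →₀ ℂ) :
    compL t (compL t f g) h = compL t f (compL t g h) := by
  induction f using induction_ev t with
  | h0 => simp
  | hadd f f' h1 h2 => simp only [map_add, LinearMap.add_apply, h1, h2]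
  | hsmul c f h1 => simp only [map_smul, LinearMap.smul_apply, h1]
  | hev A =>
  induction g using induction_ev t with
  | h0 => simp
  | hadd f f' h1 h2 => simp only [map_add, LinearMap.add_apply, h1, h2]
  | hsmul c f h1 => simp only [map_smul, LinearMap.smul_apply, h1]
  | hev B =>
  induction h using induction_ev t with
  | h0 => simp
  | hadd f f' h1 h2 => simp only [map_add, h1, h2]
  | hsmul c f h1 => simp only [map_smul, h1]
  | hev C => simp only [compL_ev, mulT_assoc]

/-- The identity as a linear combination. -/
noncomputable def oneL (n : ℕ) : CPart n n →₀ ℂ :=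
  Finsupp.single (ofPartition (Partition.idn n)) 1

theorem oneL_eq (t : ℂ) (n : ℕ) : oneL n = ev t (one n) := by simp [oneL, ev, one]

theorem oneL_compL (t : ℂ) (f : CPart k l →₀ ℂ) : compL t (oneL k) f = f := by
  induction f using induction_ev t with
  | h0 => simp
  | hadd f f' h1 h2 => simp only [map_add, h1, h2]
  | hsmul c f h1 => simp only [map_smul, h1]
  | hev A => rw [oneL_eq t, compL_ev, one_mulT]

theorem compL_oneL (t : ℂ) (f : CPart k l →₀ ℂ) : compL t f (oneL l) = f := by
  induction f using induction_ev t with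
  | h0 => simp
  | hadd f f' h1 h2 => simp only [map_add, LinearMap.add_apply, h1, h2]
  | hsmul c f h1 => simp only [map_smul, LinearMap.smul_apply, h1]
  | hev A => rw [oneL_eq t, compL_ev, mulT_one]

theorem tensL_oneL : tensL (oneL k) (oneL l) = oneL (k + l) := by
  rw [oneL_eq 0, oneL_eq 0, oneL_eq 0, tensL_ev, tensT_one]

theorem compL_tensL (t : ℂ) (f : CPart k l →₀ ℂ) (f' : CPart k' l' →₀ ℂ) (g : CPart l m →₀ ℂ)
    (g' : CPart l' m' →₀ ℂ) :
    compL t (tensL f f') (tensL g g') = tensL (compL t f g) (compL t f' g') := by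
  induction f using induction_ev t with
  | h0 => simp
  | hadd f f' h1 h2 => simp only [map_add, LinearMap.add_apply, h1, h2]
  | hsmul c f h1 => simp only [map_smul, LinearMap.smul_apply, h1]
  | hev A =>
  induction f' using induction_ev t with
  | h0 => simp
  | hadd f f' h1 h2 => simp only [map_add, LinearMap.add_apply, h1, h2]
  | hsmul c f h1 => simp only [map_smul, LinearMap.smul_apply, h1]
  | hev A' =>
  induction g using induction_ev t with
  | h0 => simp
  | hadd f f' h1 h2 => simp only [map_add, LinearMap.add_apply, h1, h2]
  | hsmul c f h1 => simp only [map_smul, LinearMap.smul_apply, h1]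
  | hev B =>
  induction g' using induction_ev t with
  | h0 => simp
  | hadd f f' h1 h2 => simp only [map_add, h1, h2]
  | hsmul c f h1 => simp only [map_smul, h1]
  | hev B' => simp only [compL_ev, tensL_ev, mulT_tensT]

/-- Change of the sizes along equalities. -/
noncomputable def castL {k l k' l' : ℕ} (hk : k = k') (hl : l = l') :
    (CPart k l →₀ ℂ) →ₗ[ℂ] (CPart k' l' →₀ ℂ) := hk ▸ hl ▸ LinearMap.id

theorem castL_ev (t : ℂ) (hk : k = k') (hl : l = l') (A : Term k l) :
    castL hk hl (ev t A) = ev t (castT hk hl A) := by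
  subst hk hl
  rfl

theorem tensL_assoc {k₁ l₁ k₂ l₂ k₃ l₃ : ℕ} (f : CPart k₁ l₁ →₀ ℂ) (g : CPart k₂ l₂ →₀ ℂ)
    (h : CPart k₃ l₃ →₀ ℂ) :
    castL (add_assoc _ _ _) (add_assoc _ _ _) (tensL (tensL f g) h) = tensL f (tensL g h) := by
  induction f using induction_ev 0 with
  | h0 => simp
  | hadd f f' h1 h2 => simp only [map_add, LinearMap.add_apply, h1, h2]
  | hsmul c f h1 => simp only [map_smul, LinearMap.smul_apply, h1]
  | hev A =>
  induction g using induction_ev 0 with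
  | h0 => simp
  | hadd f f' h1 h2 => simp only [map_add, LinearMap.add_apply, h1, h2]
  | hsmul c f h1 => simp only [map_smul, LinearMap.smul_apply, h1]
  | hev B =>
  induction h using induction_ev 0 with
  | h0 => simp
  | hadd f f' h1 h2 => simp only [map_add, h1, h2]
  | hsmul c f h1 => simp only [map_smul, h1]
  | hev C => simp only [tensL_ev, castL_ev, tensT_assoc]

theorem oneL_tensL (f : CPart k l →₀ ℂ) :
    castL (zero_add _) (zero_add _) (tensL (oneL 0) f) = f := by
  induction f using induction_ev 0 with
  | h0 => simp
  | hadd f f' h1 h2 => simp only [map_add, h1, h2]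
  | hsmul c f h1 => simp only [map_smul, h1]
  | hev A => rw [oneL_eq 0, tensL_ev, castL_ev, one_tensT]

theorem tensL_one' (f : CPart k l →₀ ℂ) :
    castL (add_zero _) (add_zero _) (tensL f (oneL 0)) = f := by
  induction f using induction_ev 0 with
  | h0 => simp
  | hadd f f' h1 h2 => simp only [map_add, LinearMap.add_apply, h1, h2]
  | hsmul c f h1 => simp only [map_smul, LinearMap.smul_apply, h1]
  | hev A => rw [oneL_eq 0, tensL_ev, castL_ev, tensT_one']

end CPart

/-! ### The category `Par(ℤ₂, t)` -/

/-- The category `Par(ℤ₂, t)`; its objects are the `[ñ]` for natural numbers `n`. -/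
structure ParZ2 (t : ℂ) where
  n : ℕ

namespace ParZ2

open CPart MonoidalCategory

variable {t : ℂ}

noncomputable instance : Category (ParZ2 t) where
  Hom X Y := CPart X.n Y.n →₀ ℂ
  id X := oneL X.n
  comp f g := compL t f g
  id_comp f := oneL_compL t f
  comp_id f := compL_oneL t f
  assoc f g h := compL_assoc t f g h

noncomputable instance homGroup (X Y : ParZ2 t) : AddCommGroup (X ⟶ Y) :=
  (Finsupp.instAddCommGroup : AddCommGroup (CPart X.n Y.n →₀ ℂ))

noncomputable instance homModule (X Y : ParZ2 t) : Module ℂ (X ⟶ Y) :=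
  (Finsupp.module _ _ : Module ℂ (CPart X.n Y.n →₀ ℂ))

theorem add_comp' (X Y Z : ParZ2 t) (f f' : X ⟶ Y) (g : Y ⟶ Z) :
    (f + f') ≫ g = f ≫ g + f' ≫ g := by
  refine Eq.trans (b := compL t (f + f' : CPart X.n Y.n →₀ ℂ) g) rfl ?_
  rw [map_add]
  rfl

theorem comp_add' (X Y Z : ParZ2 t) (f : X ⟶ Y) (g g' : Y ⟶ Z) :
    f ≫ (g + g') = f ≫ g + f ≫ g' := by
  refine Eq.trans (b := compL t f (g + g' : CPart Y.n Z.n →₀ ℂ)) rfl ?_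
  rw [map_add]
  rfl

noncomputable instance : Preadditive (ParZ2 t) where
  homGroup := homGroup
  add_comp := add_comp'
  comp_add := comp_add'

theorem smul_comp' (X Y Z : ParZ2 t) (r : ℂ) (f : X ⟶ Y) (g : Y ⟶ Z) :
    (r • f) ≫ g = r • (f ≫ g) := by
  refine Eq.trans (b := compL t (r • f : CPart X.n Y.n →₀ ℂ) g) rfl ?_
  rw [map_smul]
  rfl

theorem comp_smul' (X Y Z : ParZ2 t) (f : X ⟶ Y) (r : ℂ) (g : Y ⟶ Z) :
    f ≫ (r • g) = r • (f ≫ g) := by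
  refine Eq.trans (b := compL t f (r • g : CPart Y.n Z.n →₀ ℂ)) rfl ?_
  rw [map_smul]
  rfl

noncomputable instance : Linear ℂ (ParZ2 t) where
  homModule := homModule
  smul_comp := smul_comp'
  comp_smul := comp_smul'

theorem castL_eq {X X' Y Y' : ParZ2 t} (hX : X = X') (hY : Y = Y') (f : X ⟶ Y) :
    (castL (congrArg n hX) (congrArg n hY) f : X' ⟶ Y') =
      eqToHom hX.symm ≫ f ≫ eqToHom hY := by
  subst hX hY
  simp
  rfl

/-- The tensor product is `[k̃] ⊗ [l̃] = [(k+l)~]` on objects and horizontal concatenation on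
morphisms; associators and unitors are identities. -/
noncomputable instance : MonoidalCategoryStruct (ParZ2 t) where
  tensorObj X Y := ⟨X.n + Y.n⟩
  tensorHom f g := tensL f g
  whiskerLeft X _ _ f := tensL (oneL X.n) f
  whiskerRight f Y := tensL f (oneL Y.n)
  tensorUnit := ⟨0⟩
  associator X Y Z := eqToIso (congrArg mk (add_assoc X.n Y.n Z.n))
  leftUnitor X := eqToIso (congrArg mk (zero_add X.n))
  rightUnitor X := eqToIso (congrArg mk (add_zero X.n))

theorem id_tensor_id (X Y : ParZ2 t) : 𝟙 X ⊗ₘ 𝟙 Y = 𝟙 (X ⊗ Y) := tensL_oneL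

theorem eqToHom_tensor {X X' Y Y' : ParZ2 t} (hX : X = X') (hY : Y = Y') :
    eqToHom hX ⊗ₘ eqToHom hY = eqToHom (congrArg₂ tensorObj hX hY) := by
  subst hX hY
  exact id_tensor_id _ _

theorem associator_def (X Y Z : ParZ2 t) :
    (α_ X Y Z).hom = eqToHom (congrArg mk (add_assoc X.n Y.n Z.n)) := rfl

theorem leftUnitor_def (X : ParZ2 t) :
    (λ_ X).hom = eqToHom (congrArg mk (zero_add X.n)) := rfl

theorem rightUnitor_def (X : ParZ2 t) :
    (ρ_ X).hom = eqToHom (congrArg mk (add_zero X.n)) := rfl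

theorem id_eqToHom_tensor (X : ParZ2 t) {Y Y' : ParZ2 t} (hY : Y = Y') :
    𝟙 X ⊗ₘ eqToHom hY = eqToHom (congrArg (tensorObj X) hY) :=
  eqToHom_tensor rfl hY

theorem eqToHom_id_tensor {X X' : ParZ2 t} (hX : X = X') (Y : ParZ2 t) :
    eqToHom hX ⊗ₘ 𝟙 Y = eqToHom (congrArg (tensorObj · Y) hX) :=
  eqToHom_tensor hX rfl

theorem tensor_assoc {X₁ X₂ X₃ Y₁ Y₂ Y₃ : ParZ2 t} (f : X₁ ⟶ Y₁) (g : X₂ ⟶ Y₂) (h : X₃ ⟶ Y₃) :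
    ((f ⊗ₘ g) ⊗ₘ h) ≫ (α_ Y₁ Y₂ Y₃).hom = (α_ X₁ X₂ X₃).hom ≫ (f ⊗ₘ (g ⊗ₘ h)) := by
  have h1 : eqToHom _ ≫ ((f ⊗ₘ g) ⊗ₘ h) ≫ eqToHom _ = f ⊗ₘ (g ⊗ₘ h) :=
    (castL_eq (congrArg mk (add_assoc X₁.n X₂.n X₃.n))
      (congrArg mk (add_assoc Y₁.n Y₂.n Y₃.n)) ((f ⊗ₘ g) ⊗ₘ h)).symm.trans (tensL_assoc f g h)
  rw [← h1, associator_def, associator_def, eqToHom_trans_assoc, eqToHom_refl, Category.id_comp]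

theorem left_unit {X Y : ParZ2 t} (f : X ⟶ Y) :
    (𝟙 (𝟙_ (ParZ2 t)) ⊗ₘ f) ≫ (λ_ Y).hom = (λ_ X).hom ≫ f := by
  have h1 : eqToHom _ ≫ (𝟙 (𝟙_ (ParZ2 t)) ⊗ₘ f) ≫ eqToHom _ = f :=
    (castL_eq (congrArg mk (zero_add X.n)) (congrArg mk (zero_add Y.n))
      (𝟙 (𝟙_ (ParZ2 t)) ⊗ₘ f)).symm.trans (oneL_tensL f)
  conv_rhs => rw [← h1]
  rw [leftUnitor_def, leftUnitor_def, eqToHom_trans_assoc, eqToHom_refl, Category.id_comp]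

theorem right_unit {X Y : ParZ2 t} (f : X ⟶ Y) :
    (f ⊗ₘ 𝟙 (𝟙_ (ParZ2 t))) ≫ (ρ_ Y).hom = (ρ_ X).hom ≫ f := by
  have h1 : eqToHom _ ≫ (f ⊗ₘ 𝟙 (𝟙_ (ParZ2 t))) ≫ eqToHom _ = f :=
    (castL_eq (congrArg mk (add_zero X.n)) (congrArg mk (add_zero Y.n))
      (f ⊗ₘ 𝟙 (𝟙_ (ParZ2 t)))).symm.trans (tensL_one' f)
  conv_rhs => rw [← h1]
  rw [rightUnitor_def, rightUnitor_def, eqToHom_trans_assoc]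
  exact (Category.id_comp _).symm

theorem pentagon_eq (W X Y Z : ParZ2 t) :
    ((α_ W X Y).hom ⊗ₘ 𝟙 Z) ≫ (α_ W (X ⊗ Y) Z).hom ≫ (𝟙 W ⊗ₘ (α_ X Y Z).hom) =
      (α_ (W ⊗ X) Y Z).hom ≫ (α_ W X (Y ⊗ Z)).hom := by
  simp only [associator_def, eqToHom_id_tensor, id_eqToHom_tensor, eqToHom_trans]

theorem triangle_eq (X Y : ParZ2 t) :
    (α_ X (𝟙_ (ParZ2 t)) Y).hom ≫ (𝟙 X ⊗ₘ (λ_ Y).hom) = (ρ_ X).hom ⊗ₘ 𝟙 Y := by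
  simp only [associator_def, leftUnitor_def, rightUnitor_def, eqToHom_id_tensor,
    id_eqToHom_tensor, eqToHom_trans]

noncomputable instance : MonoidalCategory (ParZ2 t) :=
  MonoidalCategory.ofTensorHom
    (id_tensorHom_id := id_tensor_id)
    (id_tensorHom := fun _ _ _ _ => rfl)
    (tensorHom_id := fun _ _ => rfl)
    (tensorHom_comp_tensorHom := fun f g f' g' => compL_tensL t f g f' g')
    (associator_naturality := tensor_assoc)
    (leftUnitor_naturality := left_unit)
    (rightUnitor_naturality := right_unit)
    (pentagon := pentagon_eq)
    (triangle := triangle_eq)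

theorem tensor_add' {X Y X' Y' : ParZ2 t} (f : X ⟶ Y) (g g' : X' ⟶ Y') :
    f ⊗ₘ (g + g') = f ⊗ₘ g + f ⊗ₘ g' := by
  refine Eq.trans (b := tensL f (g + g' : CPart X'.n Y'.n →₀ ℂ)) rfl ?_
  rw [map_add]
  rfl

theorem add_tensor' {X Y X' Y' : ParZ2 t} (f f' : X ⟶ Y) (g : X' ⟶ Y') :
    (f + f') ⊗ₘ g = f ⊗ₘ g + f' ⊗ₘ g := by
  refine Eq.trans (b := tensL (f + f' : CPart X.n Y.n →₀ ℂ) g) rfl ?_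
  rw [map_add]
  rfl

theorem tensor_smul' {X Y X' Y' : ParZ2 t} (r : ℂ) (f : X ⟶ Y) (g : X' ⟶ Y') :
    f ⊗ₘ (r • g) = r • (f ⊗ₘ g) := by
  refine Eq.trans (b := tensL f (r • g : CPart X'.n Y'.n →₀ ℂ)) rfl ?_
  rw [map_smul]
  rfl

theorem smul_tensor' {X Y X' Y' : ParZ2 t} (r : ℂ) (f : X ⟶ Y) (g : X' ⟶ Y') :
    (r • f) ⊗ₘ g = r • (f ⊗ₘ g) := by
  refine Eq.trans (b := tensL (r • f : CPart X.n Y.n →₀ ℂ) g) rfl ?_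
  rw [map_smul]
  rfl

instance : MonoidalPreadditive (ParZ2 t) where
  whiskerLeft_zero := by
    intros
    rw [← zero_smul ℂ (0 : _ ⟶ _), ← id_tensorHom, tensor_smul', zero_smul]
  zero_whiskerRight := by
    intros
    rw [← zero_smul ℂ (0 : _ ⟶ _), ← tensorHom_id, smul_tensor', zero_smul]
  whiskerLeft_add f g := tensor_add' _ f g
  add_whiskerRight f g := add_tensor' f g _

instance : MonoidalLinear ℂ (ParZ2 t) where
  whiskerLeft_smul _ _ _ r f := tensor_smul' r _ f
  smul_whiskerRight r _ _ f _ := smul_tensor' r f _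

end ParZ2

/-! ### Even partitions -/

namespace Partition

variable {k l m k' l' : ℕ}

theorem IsEven.ncard_of_closed {p : Partition k l} (hp : p.IsEven) (K : Set (Fin k ⊕ Fin l))
    (hK : ∀ u v, p u v → u ∈ K → v ∈ K) : Even K.ncard := by
  induction hn : K.ncard using Nat.strong_induction_on generalizing K with | _ n ih =>
  rcases K.eq_empty_or_nonempty with rfl | ⟨u, hu⟩
  · simp at hn
    simp [← hn]
  · have hC : {v | p v u} ⊆ K := fun v hv => hK u v (p.symm hv) hu
    have h1 := Set.ncard_sdiff_add_ncard_of_subset hC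
    have h2 : 0 < {v | p v u}.ncard :=
      (Set.ncard_pos (Set.toFinite _)).2 ⟨u, p.refl u⟩
    have h3 := ih (K \ {v | p v u}).ncard (by omega) (K \ {v | p v u})
      (fun v w hvw hv => ⟨hK v w hvw hv.1, fun hw => hv.2 (p.trans hvw hw)⟩) rfl
    rw [← hn, ← h1]
    exact h3.add (hp _ (p.mem_classes u))

theorem ncard_sum {α β : Type} [Finite α] [Finite β] (T : Set (α ⊕ β)) :
    T.ncard = (Sum.inl ⁻¹' T).ncard + (Sum.inr ⁻¹' T).ncard := by
  conv_lhs => rw [← Set.image_preimage_inl_union_image_preimage_inr T]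
  rw [Set.ncard_union_eq _ (Set.toFinite _) (Set.toFinite _),
    Set.ncard_image_of_injective _ Sum.inl_injective,
    Set.ncard_image_of_injective _ Sum.inr_injective]
  rw [Set.disjoint_left]
  rintro _ ⟨a, _, rfl⟩ ⟨b, _, hb⟩
  cases hb

theorem IsEven.vcomp {p : Partition k l} {q : Partition l m} (hp : p.IsEven) (hq : q.IsEven) :
    (p.vcomp q).IsEven := by
  rintro _ ⟨u, rfl⟩
  let K : Set (Fin k ⊕ Fin l ⊕ Fin m) := {w | stack p q w (outer u)}
  have hK : ∀ a b, StackRel p q a b → a ∈ K → b ∈ K := fun a b hab ha =>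
    (stack p q).trans ((stack p q).symm (Relation.EqvGen.rel _ _ hab)) ha
  have h1 := hp.ncard_of_closed (low ⁻¹' K) fun a b hab ha => hK _ _ (StackRel.low hab) ha
  have h2 := hq.ncard_of_closed (high ⁻¹' K) fun a b hab ha => hK _ _ (StackRel.high hab) ha
  rw [ncard_sum, Nat.even_iff] at h1 h2
  rw [ncard_sum, Nat.even_iff]
  change ((Sum.inl ⁻¹' K).ncard + ((Sum.inr ∘ Sum.inl) ⁻¹' K).ncard) % 2 = 0 at h1
  change (((Sum.inr ∘ Sum.inl) ⁻¹' K).ncard + ((Sum.inr ∘ Sum.inr) ⁻¹' K).ncard) % 2 = 0 at h2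
  change ((Sum.inl ⁻¹' K).ncard + ((Sum.inr ∘ Sum.inr) ⁻¹' K).ncard) % 2 = 0
  omega

theorem isEven_idn (n : ℕ) : (idn n).IsEven := by
  rintro _ ⟨u, rfl⟩
  obtain ⟨a, ha⟩ : ∃ a, Sum.elim id id u = a := ⟨_, rfl⟩
  have : {x | idn n x u} = {Sum.inl a, Sum.inr a} := by
    ext x
    change Sum.elim id id x = Sum.elim id id u ↔ _
    rw [ha]
    rcases x with x | x <;> simp
  rw [this, Set.ncard_pair (by simp)]
  exact even_two

theorem IsEven.tens {p : Partition k l} {q : Partition k' l'} (hp : p.IsEven) (hq : q.IsEven) :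
    (p.tens q).IsEven := by
  rintro _ ⟨u, rfl⟩
  rcases CPart.left_or_right u with ⟨a, rfl⟩ | ⟨a, rfl⟩
  · have : {x | p.tens q x (CPart.left k l k' l' a)} = CPart.left k l k' l' '' {x | p x a} := by
      ext x
      change Sum.LiftRel _ _ _ _ ↔ _
      rw [CPart.split_left]
      constructor
      · rcases CPart.left_or_right x with ⟨b, rfl⟩ | ⟨b, rfl⟩
        · rw [CPart.split_left, Sum.liftRel_inl_inl]
          exact fun h => ⟨b, h, rfl⟩
        · rw [CPart.split_right]
          intro h
          cases h
      · rintro ⟨b, hb, rfl⟩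
        rw [CPart.split_left]
        exact Sum.LiftRel.inl hb
    rw [this, Set.ncard_image_of_injective]
    · exact hp _ (p.mem_classes a)
    · intro b c hbc
      have := congrArg (split k l k' l') hbc
      rwa [CPart.split_left, CPart.split_left, Sum.inl.injEq] at this
  · have : {x | p.tens q x (CPart.right k l k' l' a)} = CPart.right k l k' l' '' {x | q x a} := by
      ext x
      change Sum.LiftRel _ _ _ _ ↔ _
      rw [CPart.split_right]
      constructor
      · rcases CPart.left_or_right x with ⟨b, rfl⟩ | ⟨b, rfl⟩
        · rw [CPart.split_left]
          intro h
          cases h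
        · rw [CPart.split_right, Sum.liftRel_inr_inr]
          exact fun h => ⟨b, h, rfl⟩
      · rintro ⟨b, hb, rfl⟩
        rw [CPart.split_right]
        exact Sum.LiftRel.inr hb
    rw [this, Set.ncard_image_of_injective]
    · exact hq _ (q.mem_classes a)
    · intro b c hbc
      have := congrArg (split k l k' l') hbc
      rwa [CPart.split_right, CPart.split_right, Sum.inr.injEq] at this

end Partition

namespace CPart

variable {k l m k' l' : ℕ}

/-- Vertical concatenation does not depend on the choice of compatible representatives. -/
theorem vcomp_mk {x : ColouredDiagram k l} {y : ColouredDiagram l m} (h : x.Compatible y) :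
    vcomp (mk x) (mk y) = some (mk (x.vcomp y)) := by
  classical
  have hC : Compatible (mk x) (mk y) := ⟨(x, y), rfl, rfl, h⟩
  rw [vcomp, dif_pos hC]
  congr 1
  refine ext_sat fun f => ?_
  have e : ∀ {k l : ℕ} {x y : ColouredDiagram k l}, mk x = mk y → ∀ f, Adm x f ↔ Adm y f :=
    fun {k l x y} h f => ⟨adm_of_equiv (Quotient.exact h) f,
      adm_of_equiv (Quotient.exact h.symm) f⟩
  have h1 := card_middle h (fun i => f (Sum.inl i)) (fun i => f (Sum.inr i))
  have h2 := card_middle hC.choose_spec.2.2 (fun i => f (Sum.inl i)) (fun i => f (Sum.inr i))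
  simp only [e hC.choose_spec.1, e hC.choose_spec.2.1] at h2
  rw [h1] at h2
  have hf : Sum.elim (fun i => f (Sum.inl i)) (fun i => f (Sum.inr i)) = f :=
    Sum.elim_comp_inl_inr f
  have h4 : ∀ n : ℕ, 4 ^ n ≠ 0 := fun n => by positivity
  rw [hf] at h2
  rw [sat_mk, sat_mk]
  split_ifs at h2 with h5 h6 h6
  · exact iff_of_true h6 h5
  · exact absurd h2 (h4 _)
  · exact absurd h2.symm (h4 _)
  · exact iff_of_false h6 h5

theorem vcomp_ofPartition (p : Partition k l) (q : Partition l m) :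
    vcomp (ofPartition p) (ofPartition q) = some (ofPartition (p.vcomp q)) := by
  refine (vcomp_mk (fun i j _ => rfl)).trans ?_
  congr 2
  refine congrArg (ColouredDiagram.mk _) (funext fun u => ?_)
  rcases u with u | u
  · rfl
  · simp [ColouredDiagram.middleLabel]

theorem tens_ofPartition (p : Partition k l) (q : Partition k' l') :
    tens (ofPartition p) (ofPartition q) = ofPartition (p.tens q) := by
  change mk (ColouredDiagram.tens _ _) = mk _
  congr 1
  refine congrArg (ColouredDiagram.mk _) (funext fun u => ?_)
  rcases h : Partition.split k l k' l' u with w | w <;> simp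

theorem ofPartition_injective : Function.Injective (ofPartition (k := k) (l := l)) :=
  fun _ _ h => congrArg part h

end CPart

/-- Even partitions: the set `P_even(k, l)`. -/
@[ext]
structure EvenPart (k l : ℕ) where
  part : Partition k l
  even : part.IsEven

namespace EvenPart

variable {k l m k' l' : ℕ}

/-- The composite `t ^ l(q, p) q p` of even partitions. -/
noncomputable def compBasis (t : ℂ) (p : EvenPart k l) (q : EvenPart l m) : EvenPart k m →₀ ℂ :=
  Finsupp.single ⟨p.part.vcomp q.part, p.even.vcomp q.even⟩ (t ^ p.part.loops q.part)

/-- Bilinear extension of the composition of even partitions. -/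
noncomputable def compL (t : ℂ) :
    (EvenPart k l →₀ ℂ) →ₗ[ℂ] (EvenPart l m →₀ ℂ) →ₗ[ℂ] (EvenPart k m →₀ ℂ) :=
  Finsupp.linearCombination ℂ fun p => Finsupp.linearCombination ℂ fun q => compBasis t p q

/-- Bilinear extension of the horizontal concatenation of even partitions. -/
noncomputable def tensL :
    (EvenPart k l →₀ ℂ) →ₗ[ℂ] (EvenPart k' l' →₀ ℂ) →ₗ[ℂ] (EvenPart (k + k') (l + l') →₀ ℂ) :=
  Finsupp.linearCombination ℂ fun p => Finsupp.linearCombination ℂ fun q =>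
    Finsupp.single ⟨p.part.tens q.part, p.even.tens q.even⟩ 1

/-- The identity partition as a linear combination. -/
noncomputable def oneL (n : ℕ) : EvenPart n n →₀ ℂ :=
  Finsupp.single ⟨Partition.idn n, Partition.isEven_idn n⟩ 1

/-- Even partitions as coloured partitions. -/
noncomputable def toC : (EvenPart k l →₀ ℂ) →ₗ[ℂ] (CPart k l →₀ ℂ) :=
  Finsupp.lmapDomain ℂ ℂ fun p => CPart.ofPartition p.part

theorem toC_single (p : EvenPart k l) (a : ℂ) :
    toC (Finsupp.single p a) = Finsupp.single (CPart.ofPartition p.part) a := by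
  simp [toC]

theorem toC_injective : Function.Injective (toC (k := k) (l := l)) :=
  Finsupp.mapDomain_injective fun _ _ h => EvenPart.ext (CPart.ofPartition_injective h)

theorem toC_compL (t : ℂ) (f : EvenPart k l →₀ ℂ) (g : EvenPart l m →₀ ℂ) :
    toC (compL t f g) = CPart.compL t (toC f) (toC g) := by
  induction f using Finsupp.induction_linear with
  | zero => simp
  | add f f' h1 h2 => simp only [map_add, LinearMap.add_apply, h1, h2]
  | single p a =>
  induction g using Finsupp.induction_linear with
  | zero => simp
  | add f f' h1 h2 => simp only [map_add, h1, h2]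
  | single q b =>
    have h : compL t (Finsupp.single p a) (Finsupp.single q b) = (a * b) • compBasis t p q := by
      simp [compL, Finsupp.linearCombination_single, smul_smul]
    rw [h, map_smul, compBasis, toC_single, toC_single, toC_single, CPart.compL_single,
      CPart.compBasis, CPart.vcomp_ofPartition]
    rfl

theorem toC_tensL (f : EvenPart k l →₀ ℂ) (g : EvenPart k' l' →₀ ℂ) :
    toC (tensL f g) = CPart.tensL (toC f) (toC g) := by
  induction f using Finsupp.induction_linear with
  | zero => simp
  | add f f' h1 h2 => simp only [map_add, LinearMap.add_apply, h1, h2]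
  | single p a =>
  induction g using Finsupp.induction_linear with
  | zero => simp
  | add f f' h1 h2 => simp only [map_add, h1, h2]
  | single q b =>
    have h : tensL (Finsupp.single p a) (Finsupp.single q b) =
        Finsupp.single ⟨p.part.tens q.part, p.even.tens q.even⟩ (a * b) := by
      simp [tensL, Finsupp.linearCombination_single]
    rw [h, toC_single, toC_single, toC_single, CPart.tensL_single, CPart.tens_ofPartition]

theorem toC_oneL (n : ℕ) : toC (oneL n) = CPart.oneL n := toC_single _ _

end EvenPart

/-! ### The category `Rep₀(H_t)` -/

/-- The category `Rep₀(H_t)`; its objects are the `[n]` for natural numbers `n`. -/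
structure RepZero (t : ℂ) where
  n : ℕ

namespace RepZero

open EvenPart MonoidalCategory

variable {t : ℂ}

noncomputable instance : Category (RepZero t) where
  Hom X Y := EvenPart X.n Y.n →₀ ℂ
  id X := oneL X.n
  comp f g := compL t f g
  id_comp f := toC_injective (by rw [toC_compL, toC_oneL, CPart.oneL_compL])
  comp_id f := toC_injective (by rw [toC_compL, toC_oneL, CPart.compL_oneL])
  assoc f g h := toC_injective (by simp only [toC_compL, CPart.compL_assoc])

noncomputable instance homGroup (X Y : RepZero t) : AddCommGroup (X ⟶ Y) :=
  (Finsupp.instAddCommGroup : AddCommGroup (EvenPart X.n Y.n →₀ ℂ))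

noncomputable instance homModule (X Y : RepZero t) : Module ℂ (X ⟶ Y) :=
  (Finsupp.module _ _ : Module ℂ (EvenPart X.n Y.n →₀ ℂ))

theorem add_comp' (X Y Z : RepZero t) (f f' : X ⟶ Y) (g : Y ⟶ Z) :
    (f + f') ≫ g = f ≫ g + f' ≫ g := by
  refine Eq.trans (b := compL t (f + f' : EvenPart X.n Y.n →₀ ℂ) g) rfl ?_
  rw [map_add]
  rfl

theorem comp_add' (X Y Z : RepZero t) (f : X ⟶ Y) (g g' : Y ⟶ Z) :
    f ≫ (g + g') = f ≫ g + f ≫ g' := by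
  refine Eq.trans (b := compL t f (g + g' : EvenPart Y.n Z.n →₀ ℂ)) rfl ?_
  rw [map_add]
  rfl

noncomputable instance : Preadditive (RepZero t) where
  homGroup := homGroup
  add_comp := add_comp'
  comp_add := comp_add'

theorem smul_comp' (X Y Z : RepZero t) (r : ℂ) (f : X ⟶ Y) (g : Y ⟶ Z) :
    (r • f) ≫ g = r • (f ≫ g) := by
  refine Eq.trans (b := compL t (r • f : EvenPart X.n Y.n →₀ ℂ) g) rfl ?_
  rw [map_smul]
  rfl

theorem comp_smul' (X Y Z : RepZero t) (f : X ⟶ Y) (r : ℂ) (g : Y ⟶ Z) :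
    f ≫ (r • g) = r • (f ≫ g) := by
  refine Eq.trans (b := compL t f (r • g : EvenPart Y.n Z.n →₀ ℂ)) rfl ?_
  rw [map_smul]
  rfl

noncomputable instance : Linear ℂ (RepZero t) where
  homModule := homModule
  smul_comp := smul_comp'
  comp_smul := comp_smul'

/-- The tensor product is `[k] ⊗ [l] = [k+l]` on objects and horizontal concatenation on
morphisms; associators and unitors are identities. -/
noncomputable instance : MonoidalCategoryStruct (RepZero t) where
  tensorObj X Y := ⟨X.n + Y.n⟩
  tensorHom f g := tensL f g
  whiskerLeft X _ _ f := tensL (oneL X.n) f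
  whiskerRight f Y := tensL f (oneL Y.n)
  tensorUnit := ⟨0⟩
  associator X Y Z := eqToIso (congrArg mk (add_assoc X.n Y.n Z.n))
  leftUnitor X := eqToIso (congrArg mk (zero_add X.n))
  rightUnitor X := eqToIso (congrArg mk (add_zero X.n))

/-- The inclusion of even partitions into coloured partitions, for a fixed parameter. It is only
used to transfer the laws of a monoidal category. -/
noncomputable def incl (t : ℂ) : RepZero t ⥤ ParZ2 t where
  obj X := ⟨X.n⟩
  map f := toC f
  map_id X := toC_oneL X.n
  map_comp f g := toC_compL t f g

instance : (incl t).Faithful where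
  map_injective h := toC_injective h

theorem incl_tensorHom {X Y X' Y' : RepZero t} (f : X ⟶ Y) (g : X' ⟶ Y') :
    (incl t).map (f ⊗ₘ g) = (incl t).map f ⊗ₘ (incl t).map g := toC_tensL f g

theorem associator_aux {C : Type*} [Category* C] [MonoidalCategory C] (X Y Z : C) :
    (((Iso.refl ((X ⊗ Y) ⊗ Z)).symm ≪≫ ((Iso.refl (X ⊗ Y)).symm ⊗ᵢ Iso.refl Z)) ≪≫
      α_ X Y Z ≪≫ ((Iso.refl X ⊗ᵢ Iso.refl (Y ⊗ Z)) ≪≫ Iso.refl (X ⊗ Y ⊗ Z))).hom =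
      (α_ X Y Z).hom := by simp

theorem leftUnitor_aux {C : Type*} [Category* C] [MonoidalCategory C] (X : C) :
    (((Iso.refl (𝟙_ C ⊗ X)).symm ≪≫ ((Iso.refl (𝟙_ C)).symm ⊗ᵢ Iso.refl X)) ≪≫ λ_ X).hom =
      (λ_ X).hom := by simp

theorem rightUnitor_aux {C : Type*} [Category* C] [MonoidalCategory C] (X : C) :
    (((Iso.refl (X ⊗ 𝟙_ C)).symm ≪≫ (Iso.refl X ⊗ᵢ (Iso.refl (𝟙_ C)).symm)) ≪≫ ρ_ X).hom =
      (ρ_ X).hom := by simp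

noncomputable instance : MonoidalCategory (RepZero t) :=
  Monoidal.induced (incl t)
    { μIso := fun _ _ => Iso.refl _
      εIso := Iso.refl _
      whiskerLeft_eq := fun X _ _ f => by
        have h : (incl t).map (X ◁ f) = (incl t).obj X ◁ (incl t).map f :=
          (toC_tensL (oneL X.n) f).trans (congrArg (CPart.tensL · _) (toC_oneL X.n))
        rw [h]
        exact ((Category.id_comp _).trans (Category.comp_id _)).symm
      whiskerRight_eq := fun {X X'} f Y => by
        have h : (incl t).map (f ▷ Y) = (incl t).map f ▷ (incl t).obj Y :=
          (toC_tensL f (oneL Y.n)).trans (congrArg (CPart.tensL _ ·) (toC_oneL Y.n))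
        rw [h]
        exact ((Category.id_comp _).trans (Category.comp_id _)).symm
      tensorHom_eq := fun f g => by
        rw [incl_tensorHom]
        exact ((Category.id_comp _).trans (Category.comp_id _)).symm
      associator_eq := fun X Y Z =>
        (eqToHom_map (incl t) (congrArg mk (add_assoc X.n Y.n Z.n))).trans
          (associator_aux ((incl t).obj X) ((incl t).obj Y) ((incl t).obj Z)).symm
      leftUnitor_eq := fun X =>
        (eqToHom_map (incl t) (congrArg mk (zero_add X.n))).trans
          (leftUnitor_aux ((incl t).obj X)).symm
      rightUnitor_eq := fun X =>
        (eqToHom_map (incl t) (congrArg mk (add_zero X.n))).trans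
          (rightUnitor_aux ((incl t).obj X)).symm }

end RepZero

/-! ### The additive envelope and the Karoubian envelope -/

section Envelopes

open CategoryTheory.MonoidalCategory

universe v u

variable {C : Type u} [Category.{v} C] [Preadditive C]

namespace MatAux

open Classical in
/-- The matrix with exactly one nonzero entry in each row. -/
noncomputable def rel {M N : Mat_ C} (e : M.ι → N.ι) (φ : ∀ i, M.X i ⟶ N.X (e i)) : M ⟶ N :=
  fun i j => if h : e i = j then φ i ≫ eqToHom (congrArg N.X h) else 0

theorem rel_self {M N : Mat_ C} (e : M.ι → N.ι) (φ : ∀ i, M.X i ⟶ N.X (e i)) (i) :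
    rel e φ i (e i) = φ i := by simp [rel]

theorem rel_of_ne {M N : Mat_ C} (e : M.ι → N.ι) (φ : ∀ i, M.X i ⟶ N.X (e i)) (i j)
    (h : e i ≠ j) : rel e φ i j = 0 := by simp [rel, h]

theorem id_eq_rel (M : Mat_ C) : 𝟙 M = rel id fun i => 𝟙 (M.X i) := by
  ext i j
  by_cases h : i = j
  · subst h
    rw [Mat_.id_apply_self]
    exact (rel_self (N := M) id (fun i => 𝟙 (M.X i)) i).symm
  · rw [Mat_.id_apply_of_ne _ _ _ h]
    exact (rel_of_ne (N := M) id _ i j h).symm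

theorem rel_comp {M N K : Mat_ C} (e : M.ι → N.ι) (φ : ∀ i, M.X i ⟶ N.X (e i)) (f : N ⟶ K)
    (i k) : (rel e φ ≫ f) i k = φ i ≫ f (e i) k := by
  rw [Mat_.comp_apply, Finset.sum_eq_single (e i), rel_self]
  · intro j _ hj
    rw [rel_of_ne _ _ _ _ hj.symm, Limits.zero_comp]
  · simp

theorem comp_rel {M N K : Mat_ C} (e : N.ι ≃ K.ι) (φ : ∀ i, N.X i ⟶ K.X (e i)) (f : M ⟶ N)
    (i j) : (f ≫ rel e φ) i (e j) = f i j ≫ φ j := by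
  rw [Mat_.comp_apply, Finset.sum_eq_single j, rel_self]
  · intro j' _ hj
    rw [rel_of_ne _ _ _ _ (fun h => hj (e.injective h)), Limits.comp_zero]
  · simp

theorem rel_comp_rel {M N K : Mat_ C} (e : M.ι → N.ι) (φ : ∀ i, M.X i ⟶ N.X (e i))
    (e' : N.ι → K.ι) (φ' : ∀ i, N.X i ⟶ K.X (e' i)) :
    rel e φ ≫ rel e' φ' = rel (fun i => e' (e i)) fun i => φ i ≫ φ' (e i) := by
  ext i k
  rw [rel_comp]
  by_cases h : e' (e i) = k
  · subst h
    rw [rel_self, rel_self (N := K) (fun i => e' (e i))]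
  · rw [rel_of_ne _ _ _ _ h, rel_of_ne (N := K) (fun i => e' (e i)) _ _ _ h, Limits.comp_zero]

/-- An isomorphism that permutes the summands. -/
noncomputable def relIso {M N : Mat_ C} (e : M.ι ≃ N.ι) (φ : ∀ i, M.X i ≅ N.X (e i)) : M ≅ N where
  hom := rel e fun i => (φ i).hom
  inv := rel e.symm fun j =>
    eqToHom (congrArg N.X (e.apply_symm_apply j).symm) ≫ (φ (e.symm j)).inv
  hom_inv_id := by
    ext i k
    rw [rel_comp]
    by_cases h : i = k
    · subst h
      rw [Mat_.id_apply_self]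
      have : ∀ i' (h : i' = i), (φ i).hom ≫ (rel (M := N) (N := M) e.symm fun j =>
          eqToHom (congrArg N.X (e.apply_symm_apply j).symm) ≫ (φ (e.symm j)).inv) (e i) i' =
          eqToHom (congrArg M.X h.symm) := by
        intro i' h
        obtain rfl : i' = e.symm (e i) := by rw [h, e.symm_apply_apply]
        rw [rel_self]
        have h2 : ∀ i'' (h' : i'' = i), (φ i).hom ≫ eqToHom (congrArg (fun a => N.X (e a)) h'.symm) ≫
            (φ i'').inv = eqToHom (congrArg M.X h'.symm) := by
          rintro _ rfl
          simp
        exact h2 _ h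
      exact this i rfl
    · rw [Mat_.id_apply_of_ne _ _ _ h, rel_of_ne, Limits.comp_zero]
      simpa using h
  inv_hom_id := by
    ext j k
    rw [rel_comp]
    by_cases h : j = k
    · subst h
      rw [Mat_.id_apply_self]
      have : ∀ j' (h : e (e.symm j) = j'), (φ (e.symm j)).inv ≫
          rel (N := N) e (fun i => (φ i).hom) (e.symm j) j' = eqToHom (congrArg N.X h) := by
        rintro _ rfl
        rw [rel_self]
        simp
      rw [Category.assoc, this j (e.apply_symm_apply j), eqToHom_trans, eqToHom_refl]
    · rw [Mat_.id_apply_of_ne _ _ _ h, rel_of_ne, Limits.comp_zero]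
      simpa using h

variable [MonoidalCategory C]

/-- The tensor product of matrices (the Kronecker product). -/
def tens {M N M' N' : Mat_ C} (f : M ⟶ N) (g : M' ⟶ N') :
    (Mat_.mk (M.ι × M'.ι) fun p => M.X p.1 ⊗ M'.X p.2) ⟶
      Mat_.mk (N.ι × N'.ι) fun p => N.X p.1 ⊗ N'.X p.2 :=
  fun p q => f p.1 q.1 ⊗ₘ g p.2 q.2

noncomputable instance : MonoidalCategoryStruct (Mat_ C) where
  tensorObj M N := ⟨M.ι × N.ι, fun p => M.X p.1 ⊗ N.X p.2⟩
  tensorHom f g := tens f g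
  whiskerLeft M _ _ f := tens (𝟙 M) f
  whiskerRight f N := tens f (𝟙 N)
  tensorUnit := ⟨Unit, fun _ => 𝟙_ C⟩
  associator M N K := relIso (Equiv.prodAssoc _ _ _) fun i => α_ (M.X i.1.1) (N.X i.1.2) (K.X i.2)
  leftUnitor M := relIso (Equiv.punitProd _) fun i => λ_ (M.X i.2)
  rightUnitor M := relIso (Equiv.prodPUnit _) fun i => ρ_ (M.X i.1)

variable [MonoidalPreadditive C]

theorem rel_tens_rel {M N M' N' : Mat_ C} (e : M.ι → N.ι) (φ : ∀ i, M.X i ⟶ N.X (e i))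
    (e' : M'.ι → N'.ι) (φ' : ∀ i, M'.X i ⟶ N'.X (e' i)) :
    rel e φ ⊗ₘ rel e' φ' =
      rel (M := M ⊗ M') (N := N ⊗ N') (fun p => (e p.1, e' p.2)) fun p => φ p.1 ⊗ₘ φ' p.2 := by
  ext p q
  change rel e φ p.1 q.1 ⊗ₘ rel e' φ' p.2 q.2 = _
  by_cases h : e p.1 = q.1
  · by_cases h' : e' p.2 = q.2
    · obtain rfl : (e p.1, e' p.2) = q := Prod.ext h h'
      exact (congrArg₂ _ (rel_self e φ _) (rel_self e' φ' _)).trans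
        (rel_self (M := M ⊗ M') (N := N ⊗ N') (fun p => (e p.1, e' p.2))
          (fun p => φ p.1 ⊗ₘ φ' p.2) p).symm
    · rw [rel_of_ne e' _ _ _ h', MonoidalPreadditive.tensor_zero]
      exact (rel_of_ne (M := M ⊗ M') (N := N ⊗ N') (fun p => (e p.1, e' p.2)) _ p q
        (fun h2 => h' (congrArg Prod.snd h2))).symm
  · rw [rel_of_ne e _ _ _ h, MonoidalPreadditive.zero_tensor]
    exact (rel_of_ne (M := M ⊗ M') (N := N ⊗ N') (fun p => (e p.1, e' p.2)) _ p q
      (fun h2 => h (congrArg Prod.fst h2))).symm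

theorem id_tens_id (M N : Mat_ C) : 𝟙 M ⊗ₘ 𝟙 N = 𝟙 (M ⊗ N) := by
  rw [id_eq_rel, id_eq_rel, id_eq_rel, rel_tens_rel]
  refine congrArg (rel (M := M ⊗ N) (N := M ⊗ N) id) (funext fun p => ?_)
  exact id_tensorHom_id _ _

theorem tens_comp {M N K M' N' K' : Mat_ C} (f : M ⟶ N) (f' : M' ⟶ N') (g : N ⟶ K)
    (g' : N' ⟶ K') : (f ⊗ₘ f') ≫ (g ⊗ₘ g') = (f ≫ g) ⊗ₘ (f' ≫ g') := by
  ext p q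
  change ∑ r : N.ι × N'.ι, (f p.1 r.1 ⊗ₘ f' p.2 r.2) ≫ (g r.1 q.1 ⊗ₘ g' r.2 q.2) =
    (∑ j, f p.1 j ≫ g j q.1) ⊗ₘ (∑ j, f' p.2 j ≫ g' j q.2)
  rw [sum_tensor, Fintype.sum_prod_type]
  refine Finset.sum_congr rfl fun j _ => ?_
  rw [tensor_sum]
  refine Finset.sum_congr rfl fun j' _ => ?_
  rw [tensorHom_comp_tensorHom]

noncomputable instance : MonoidalCategory (Mat_ C) :=
  MonoidalCategory.ofTensorHom
    (id_tensorHom_id := id_tens_id)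
    (id_tensorHom := fun _ _ _ _ => rfl)
    (tensorHom_id := fun _ _ => rfl)
    (tensorHom_comp_tensorHom := tens_comp)
    (associator_naturality := fun {X₁ X₂ X₃ Y₁ Y₂ Y₃} f g h => by
      ext p q
      obtain ⟨q, rfl⟩ := (Equiv.prodAssoc Y₁.ι Y₂.ι Y₃.ι).surjective q
      refine (comp_rel (N := (Y₁ ⊗ Y₂) ⊗ Y₃) (K := Y₁ ⊗ Y₂ ⊗ Y₃)
        (Equiv.prodAssoc Y₁.ι Y₂.ι Y₃.ι) _ ((f ⊗ₘ g) ⊗ₘ h) p q).trans ?_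
      refine Eq.trans ?_ (rel_comp (M := (X₁ ⊗ X₂) ⊗ X₃) (N := X₁ ⊗ X₂ ⊗ X₃)
        (Equiv.prodAssoc X₁.ι X₂.ι X₃.ι) _ (f ⊗ₘ (g ⊗ₘ h)) p _).symm
      exact MonoidalCategory.associator_naturality _ _ _)
    (leftUnitor_naturality := fun {X Y} f => by
      ext p q
      obtain ⟨q, rfl⟩ := (Equiv.punitProd Y.ι).surjective q
      refine (comp_rel (N := 𝟙_ _ ⊗ Y) (K := Y) (Equiv.punitProd Y.ι) _ (𝟙 _ ⊗ₘ f) p q).trans ?_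
      refine Eq.trans ?_ (rel_comp (M := 𝟙_ _ ⊗ X) (N := X) (Equiv.punitProd X.ι) _ f p _).symm
      have h : (𝟙 (𝟙_ (Mat_ C)) : 𝟙_ (Mat_ C) ⟶ _) p.1 q.1 = 𝟙 (𝟙_ C) :=
        Mat_.id_apply_self (𝟙_ (Mat_ C)) p.1
      change ((𝟙 (𝟙_ (Mat_ C)) : 𝟙_ (Mat_ C) ⟶ _) p.1 q.1 ⊗ₘ f p.2 q.2) ≫ _ = _
      rw [h]
      exact (congrArg (· ≫ _) (id_tensorHom (𝟙_ C) (f p.2 q.2))).trans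
        (MonoidalCategory.leftUnitor_naturality (f p.2 q.2)))
    (rightUnitor_naturality := fun {X Y} f => by
      ext p q
      obtain ⟨q, rfl⟩ := (Equiv.prodPUnit Y.ι).surjective q
      refine (comp_rel (N := Y ⊗ 𝟙_ _) (K := Y) (Equiv.prodPUnit Y.ι) _ (f ⊗ₘ 𝟙 _) p q).trans ?_
      refine Eq.trans ?_ (rel_comp (M := X ⊗ 𝟙_ _) (N := X) (Equiv.prodPUnit X.ι) _ f p _).symm
      have h : (𝟙 (𝟙_ (Mat_ C)) : 𝟙_ (Mat_ C) ⟶ _) p.2 q.2 = 𝟙 (𝟙_ C) :=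
        Mat_.id_apply_self (𝟙_ (Mat_ C)) p.2
      change (f p.1 q.1 ⊗ₘ (𝟙 (𝟙_ (Mat_ C)) : 𝟙_ (Mat_ C) ⟶ _) p.2 q.2) ≫ _ = _
      rw [h]
      exact (congrArg (· ≫ _) (tensorHom_id (f p.1 q.1) (𝟙_ C))).trans
        (MonoidalCategory.rightUnitor_naturality (f p.1 q.1)))
    (pentagon := fun W X Y Z => by
      rw [id_eq_rel Z, id_eq_rel W]
      change (rel (M := (W ⊗ X) ⊗ Y) (N := W ⊗ X ⊗ Y) _ _ ⊗ₘ _) ≫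
        rel (M := (W ⊗ (X ⊗ Y)) ⊗ Z) (N := W ⊗ ((X ⊗ Y) ⊗ Z)) _ _ ≫
          (_ ⊗ₘ rel (M := (X ⊗ Y) ⊗ Z) (N := X ⊗ Y ⊗ Z) _ _) =
        rel (M := ((W ⊗ X) ⊗ Y) ⊗ Z) (N := (W ⊗ X) ⊗ (Y ⊗ Z)) _ _ ≫
          rel (M := (W ⊗ X) ⊗ (Y ⊗ Z)) (N := W ⊗ X ⊗ Y ⊗ Z) _ _
      rw [rel_tens_rel, rel_tens_rel, rel_comp_rel, rel_comp_rel, rel_comp_rel]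
      refine congrArg (rel (M := ((W ⊗ X) ⊗ Y) ⊗ Z) (N := W ⊗ X ⊗ Y ⊗ Z) _) (funext fun p => ?_)
      simp only [tensorHom_id, id_tensorHom]
      exact MonoidalCategory.pentagon _ _ _ _)
    (triangle := fun X Y => by
      rw [id_eq_rel X, id_eq_rel Y]
      change rel (M := (X ⊗ 𝟙_ _) ⊗ Y) (N := X ⊗ 𝟙_ _ ⊗ Y) _ _ ≫
          (_ ⊗ₘ rel (M := 𝟙_ _ ⊗ Y) (N := Y) _ _) = rel (M := X ⊗ 𝟙_ _) (N := X) _ _ ⊗ₘ _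
      rw [rel_tens_rel, rel_tens_rel, rel_comp_rel]
      refine congrArg (rel (M := (X ⊗ 𝟙_ _) ⊗ Y) (N := X ⊗ Y) _) (funext fun p => ?_)
      simp only [tensorHom_id, id_tensorHom]
      exact MonoidalCategory.triangle _ _)

end MatAux

/-- The additive envelope of `C`: objects are finite sequences `(X₁, …, Xₙ)` of objects of `C`
(formal direct sums), morphisms are matrices of morphisms of `C`. -/
structure AddEnv (C : Type u) where
  n : ℕ
  X : Fin n → C

namespace AddEnv

open MatAux

/-- A finite sequence of objects as an object of `Mat_ C`. -/
def mat (M : AddEnv C) : Mat_ C := ⟨Fin M.n, M.X⟩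

noncomputable instance : Category (AddEnv C) where
  Hom M N := M.mat ⟶ N.mat
  id M := 𝟙 M.mat
  comp {M N K} f g := CategoryStruct.comp (X := M.mat) (Y := N.mat) (Z := K.mat) f g
  id_comp {M N} f := Category.id_comp (X := M.mat) (Y := N.mat) f
  comp_id {M N} f := Category.comp_id (X := M.mat) (Y := N.mat) f
  assoc {M N K L} f g h :=
    Category.assoc (W := M.mat) (X := N.mat) (Y := K.mat) (Z := L.mat) f g h

instance homGroup (M N : AddEnv C) : AddCommGroup (M ⟶ N) :=
  (Pi.addCommGroup : AddCommGroup (∀ (i : Fin M.n) (j : Fin N.n), M.X i ⟶ N.X j))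

noncomputable instance : Preadditive (AddEnv C) where
  homGroup := homGroup
  add_comp M N K f f' g := Preadditive.add_comp M.mat N.mat K.mat f f' g
  comp_add M N K f g g' := Preadditive.comp_add M.mat N.mat K.mat f g g'

instance homModule [Linear ℂ C] (M N : AddEnv C) : Module ℂ (M ⟶ N) :=
  (Pi.module _ _ _ : Module ℂ (∀ (i : Fin M.n) (j : Fin N.n), M.X i ⟶ N.X j))

noncomputable instance [Linear ℂ C] : Linear ℂ (AddEnv C) where
  homModule := homModule
  smul_comp M N K r f g := by
    funext i k
    change ∑ j, (r • f i j) ≫ g j k = r • ∑ j, f i j ≫ g j k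
    rw [Finset.smul_sum]
    exact Finset.sum_congr rfl fun j _ => Linear.smul_comp _ _ _ r (f i j) (g j k)
  comp_smul M N K f r g := by
    funext i k
    change ∑ j, f i j ≫ (r • g j k) = r • ∑ j, f i j ≫ g j k
    rw [Finset.smul_sum]
    exact Finset.sum_congr rfl fun j _ => Linear.comp_smul _ _ _ (f i j) r (g j k)

/-- The full embedding of `C` as the sequences of length one. -/
noncomputable def ι : C ⥤ AddEnv C where
  obj X := ⟨1, fun _ => X⟩
  map f := fun _ _ => f
  map_id X := by
    refine Mat_.hom_ext _ _ fun i j => ?_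
    obtain rfl : i = j := Subsingleton.elim (α := Fin 1) i j
    exact (Mat_.id_apply_self (mat ⟨1, fun _ => X⟩) i).symm
  map_comp f g := by
    refine Mat_.hom_ext _ _ fun i j => ?_
    exact (Fintype.sum_unique (ι := Fin 1) fun _ => f ≫ g).symm

/-- The functor to `Mat_ C`. -/
noncomputable def toMat : AddEnv C ⥤ Mat_ C where
  obj M := M.mat
  map f := f

instance : (toMat (C := C)).Faithful where
  map_injective h := h

variable [MonoidalCategory C]

/-- The tensor product `(Xᵢ) ⊗ (Yⱼ) = (Xᵢ ⊗ Yⱼ)`, in lexicographic order. -/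
def tensorObj (M N : AddEnv C) : AddEnv C :=
  ⟨M.n * N.n, fun i => M.X (finProdFinEquiv.symm i).1 ⊗ N.X (finProdFinEquiv.symm i).2⟩

/-- The unit object. -/
def unit : AddEnv C := ⟨1, fun _ => 𝟙_ C⟩

/-- Comparison of the tensor products of sequences and of objects of `Mat_ C`. -/
noncomputable def μ (M N : AddEnv C) : M.mat ⊗ N.mat ≅ (tensorObj M N).mat :=
  (relIso (M := (tensorObj M N).mat) (N := M.mat ⊗ N.mat) finProdFinEquiv.symm
    fun _ => Iso.refl _).symm

/-- Comparison of the unit objects. -/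
noncomputable def ε : 𝟙_ (Mat_ C) ≅ (unit : AddEnv C).mat :=
  relIso (M := 𝟙_ (Mat_ C)) (N := (unit : AddEnv C).mat)
    (Equiv.ofUnique Unit (Fin 1)) fun _ => Iso.refl _

/-- The Kronecker product of matrices. -/
noncomputable def kron {M N M' N' : AddEnv C} (f : M ⟶ N) (g : M' ⟶ N') :
    tensorObj M M' ⟶ tensorObj N N' :=
  let h : M.mat ⊗ M'.mat ⟶ N.mat ⊗ N'.mat :=
    tens (M := M.mat) (N := N.mat) (M' := M'.mat) (N' := N'.mat) f g
  let r : (tensorObj M M').mat ⟶ (tensorObj N N').mat := (μ M M').inv ≫ h ≫ (μ N N').hom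
  r

/-- An isomorphism in `Mat_ C` as an isomorphism of sequences. -/
noncomputable def isoOf {M N : AddEnv C} (e : M.mat ≅ N.mat) : M ≅ N where
  hom := e.hom
  inv := e.inv
  hom_inv_id := e.hom_inv_id
  inv_hom_id := e.inv_hom_id

variable [MonoidalPreadditive C]

/-- The tensor product of morphisms is the Kronecker product of matrices; associators and unitors
are those of `C`, in each component. -/
noncomputable instance : MonoidalCategoryStruct (AddEnv C) where
  tensorObj := tensorObj
  tensorHom f g := kron f g
  whiskerLeft M {_ _} f := kron (𝟙 M) f
  whiskerRight f N := kron f (𝟙 N)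
  tensorUnit := unit
  associator M N K := isoOf (((μ (tensorObj M N) K).symm ≪≫ ((μ M N).symm ⊗ᵢ .refl _)) ≪≫
    α_ M.mat N.mat K.mat ≪≫ ((.refl _ ⊗ᵢ μ N K) ≪≫ μ M (tensorObj N K)))
  leftUnitor M := isoOf (((μ unit M).symm ≪≫ (ε.symm ⊗ᵢ .refl _)) ≪≫ λ_ M.mat)
  rightUnitor M := isoOf (((μ M unit).symm ≪≫ (.refl _ ⊗ᵢ ε.symm)) ≪≫ ρ_ M.mat)

noncomputable instance : MonoidalCategory (AddEnv C) :=
  Monoidal.induced toMat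
    { μIso := μ
      εIso := ε
      whiskerLeft_eq := fun _ _ _ _ => rfl
      whiskerRight_eq := fun _ _ => rfl
      tensorHom_eq := fun _ _ => rfl
      associator_eq := fun _ _ _ => rfl
      leftUnitor_eq := fun _ => rfl
      rightUnitor_eq := fun _ => rfl }

end AddEnv

namespace KaroubiAux

open CategoryTheory.Idempotents

variable {D : Type u} [Category.{v} D]

instance homModule [Preadditive D] [Linear ℂ D] (P Q : Karoubi D) : Module ℂ (P ⟶ Q) where
  smul r f := ⟨r • f.f, by rw [Linear.smul_comp, Linear.comp_smul, f.comm]⟩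
  one_smul f := Karoubi.hom_ext _ _ (one_smul ℂ f.f)
  mul_smul r s f := Karoubi.hom_ext _ _ (mul_smul r s f.f)
  smul_zero r := Karoubi.hom_ext _ _ (smul_zero r)
  smul_add r f g := Karoubi.hom_ext _ _ (smul_add r f.f g.f)
  add_smul r s f := Karoubi.hom_ext _ _ (add_smul r s f.f)
  zero_smul f := Karoubi.hom_ext _ _ (zero_smul ℂ f.f)

instance [Preadditive D] [Linear ℂ D] : Linear ℂ (Karoubi D) where
  homModule := homModule
  smul_comp _ _ _ r f g := Karoubi.hom_ext _ _ (Linear.smul_comp _ _ _ r f.f g.f)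
  comp_smul _ _ _ f r g := Karoubi.hom_ext _ _ (Linear.comp_smul _ _ _ f.f r g.f)

variable [MonoidalCategory D]

/-- The tensor product `(X, e) ⊗ (Y, f) = (X ⊗ Y, e ⊗ f)`. -/
def tensorObj (P Q : Karoubi D) : Karoubi D :=
  ⟨P.X ⊗ Q.X, P.p ⊗ₘ Q.p, by rw [tensorHom_comp_tensorHom, P.idem, Q.idem]⟩

/-- The tensor product of morphisms is the one of the underlying morphisms. -/
def tensorHom {P P' Q Q' : Karoubi D} (f : P ⟶ P') (g : Q ⟶ Q') :
    tensorObj P Q ⟶ tensorObj P' Q' :=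
  ⟨f.f ⊗ₘ g.f, by
    dsimp only [tensorObj]
    rw [tensorHom_comp_tensorHom, tensorHom_comp_tensorHom, f.comm, g.comm]⟩

/-- The unit object. -/
def unit : Karoubi D := ⟨𝟙_ D, 𝟙 _, Category.id_comp _⟩

/-- An isomorphism of the underlying objects that commutes with the idempotents. -/
@[simps]
def isoOf {P Q : Karoubi D} (e : P.X ≅ Q.X) (h : P.p ≫ e.hom = e.hom ≫ Q.p) : P ≅ Q where
  hom := ⟨P.p ≫ e.hom, by rw [Category.assoc, ← h, P.idem_assoc, P.idem_assoc]⟩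
  inv := ⟨e.inv ≫ P.p, by
    have h' : Q.p ≫ e.inv = e.inv ≫ P.p := by rw [Iso.comp_inv_eq, Category.assoc, h]; simp
    rw [Category.assoc, P.idem, ← h', Q.idem_assoc]⟩
  hom_inv_id := Karoubi.hom_ext _ _ (by simp)
  inv_hom_id := Karoubi.hom_ext _ _ (by
    change (e.inv ≫ P.p) ≫ P.p ≫ e.hom = Q.p
    rw [Category.assoc, P.idem_assoc, h, e.inv_hom_id_assoc])

/-- Associators and unitors are those of `D`, composed with the idempotents. -/
instance : MonoidalCategoryStruct (Karoubi D) where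
  tensorObj := tensorObj
  tensorHom := tensorHom
  whiskerLeft P _ _ f := tensorHom (𝟙 P) f
  whiskerRight f P := tensorHom f (𝟙 P)
  tensorUnit := unit
  associator P Q R := isoOf (P := tensorObj (tensorObj P Q) R) (Q := tensorObj P (tensorObj Q R))
    (α_ P.X Q.X R.X) (MonoidalCategory.associator_naturality _ _ _)
  leftUnitor P := isoOf (P := tensorObj unit P) (λ_ P.X) (by simp [tensorObj, unit])
  rightUnitor P := isoOf (P := tensorObj P unit) (ρ_ P.X) (by simp [tensorObj, unit])

instance : MonoidalCategory (Karoubi D) :=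
  MonoidalCategory.ofTensorHom
    (id_tensorHom_id := fun _ _ => rfl)
    (id_tensorHom := fun _ _ _ _ => rfl)
    (tensorHom_id := fun _ _ => rfl)
    (tensorHom_comp_tensorHom := fun f g f' g' =>
      Karoubi.hom_ext _ _ (tensorHom_comp_tensorHom _ _ _ _))
    (associator_naturality := fun {P₁ P₂ P₃ Q₁ Q₂ Q₃} f g h => Karoubi.hom_ext _ _ (by
      change ((f.f ⊗ₘ g.f) ⊗ₘ h.f) ≫ ((Q₁.p ⊗ₘ Q₂.p) ⊗ₘ Q₃.p) ≫ (α_ _ _ _).hom =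
        (((P₁.p ⊗ₘ P₂.p) ⊗ₘ P₃.p) ≫ (α_ _ _ _).hom) ≫ (f.f ⊗ₘ (g.f ⊗ₘ h.f))
      rw [Category.assoc, ← MonoidalCategory.associator_naturality, ← Category.assoc,
        ← Category.assoc]
      simp only [tensorHom_comp_tensorHom, Karoubi.comp_p, Karoubi.p_comp]))
    (leftUnitor_naturality := fun {P Q} f => Karoubi.hom_ext _ _ (by
      change (𝟙 _ ⊗ₘ f.f) ≫ (𝟙 _ ⊗ₘ Q.p) ≫ (λ_ _).hom =
        ((𝟙 _ ⊗ₘ P.p) ≫ (λ_ _).hom) ≫ f.f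
      simp))
    (rightUnitor_naturality := fun {P Q} f => Karoubi.hom_ext _ _ (by
      change (f.f ⊗ₘ 𝟙 _) ≫ (Q.p ⊗ₘ 𝟙 _) ≫ (ρ_ _).hom =
        ((P.p ⊗ₘ 𝟙 _) ≫ (ρ_ _).hom) ≫ f.f
      simp))
    (pentagon := fun P Q R T => Karoubi.hom_ext _ _ (by
      change (((((P.p ⊗ₘ Q.p) ⊗ₘ R.p) ≫ (α_ _ _ _).hom) ⊗ₘ T.p) ≫
        (((P.p ⊗ₘ (Q.p ⊗ₘ R.p)) ⊗ₘ T.p) ≫ (α_ _ _ _).hom) ≫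
          (P.p ⊗ₘ (((Q.p ⊗ₘ R.p) ⊗ₘ T.p) ≫ (α_ _ _ _).hom))) =
        ((((P.p ⊗ₘ Q.p) ⊗ₘ R.p) ⊗ₘ T.p) ≫ (α_ _ _ _).hom) ≫
          (((P.p ⊗ₘ Q.p) ⊗ₘ (R.p ⊗ₘ T.p)) ≫ (α_ _ _ _).hom)
      have h1 : ((((P.p ⊗ₘ Q.p) ⊗ₘ R.p) ≫ (α_ P.X Q.X R.X).hom) ⊗ₘ T.p) =
          (((P.p ⊗ₘ Q.p) ⊗ₘ R.p) ⊗ₘ T.p) ≫ ((α_ P.X Q.X R.X).hom ▷ T.X) := by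
        rw [← tensorHom_id, tensorHom_comp_tensorHom, Category.comp_id]
      have h2 : (P.p ⊗ₘ (((Q.p ⊗ₘ R.p) ⊗ₘ T.p) ≫ (α_ Q.X R.X T.X).hom)) =
          (P.p ⊗ₘ ((Q.p ⊗ₘ R.p) ⊗ₘ T.p)) ≫ (P.X ◁ (α_ Q.X R.X T.X).hom) := by
        rw [← id_tensorHom, tensorHom_comp_tensorHom, Category.comp_id]
      have a1 : ((α_ P.X Q.X R.X).hom ▷ T.X) ≫ ((P.p ⊗ₘ (Q.p ⊗ₘ R.p)) ⊗ₘ T.p) =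
          (((P.p ⊗ₘ Q.p) ⊗ₘ R.p) ⊗ₘ T.p) ≫ ((α_ P.X Q.X R.X).hom ▷ T.X) := by
        rw [← tensorHom_id, tensorHom_comp_tensorHom, tensorHom_comp_tensorHom,
          MonoidalCategory.associator_naturality, Category.id_comp, Category.comp_id]
      have a2 := MonoidalCategory.associator_naturality P.p (Q.p ⊗ₘ R.p) T.p
      have a3 := MonoidalCategory.associator_naturality (P.p ⊗ₘ Q.p) R.p T.p
      have idem : (((P.p ⊗ₘ Q.p) ⊗ₘ R.p) ⊗ₘ T.p) ≫ (((P.p ⊗ₘ Q.p) ⊗ₘ R.p) ⊗ₘ T.p) =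
          (((P.p ⊗ₘ Q.p) ⊗ₘ R.p) ⊗ₘ T.p) := by
        simp only [tensorHom_comp_tensorHom, Karoubi.idem]
      rw [h1, h2]
      simp only [Category.assoc]
      rw [← reassoc_of% a2, ← reassoc_of% a3, reassoc_of% a1, reassoc_of% a1,
        reassoc_of% idem, reassoc_of% idem, reassoc_of% idem, MonoidalCategory.pentagon]))
    (triangle := fun P Q => Karoubi.hom_ext _ _ (by
      change (((P.p ⊗ₘ 𝟙 _) ⊗ₘ Q.p) ≫ (α_ _ _ _).hom) ≫ (P.p ⊗ₘ ((𝟙 _ ⊗ₘ Q.p) ≫ (λ_ _).hom)) =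
        ((P.p ⊗ₘ 𝟙 _) ≫ (ρ_ _).hom) ⊗ₘ Q.p
      have h1 : (P.p ⊗ₘ ((𝟙 (𝟙_ D) ⊗ₘ Q.p) ≫ (λ_ Q.X).hom)) =
          (P.p ⊗ₘ (𝟙 (𝟙_ D) ⊗ₘ Q.p)) ≫ (P.X ◁ (λ_ Q.X).hom) := by
        rw [← id_tensorHom, tensorHom_comp_tensorHom, Category.comp_id]
      have h2 : (((P.p ⊗ₘ 𝟙 (𝟙_ D)) ≫ (ρ_ P.X).hom) ⊗ₘ Q.p) =
          ((P.p ⊗ₘ 𝟙 (𝟙_ D)) ⊗ₘ Q.p) ≫ ((ρ_ P.X).hom ▷ Q.X) := by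
        rw [← tensorHom_id, tensorHom_comp_tensorHom, Category.comp_id]
      have a := MonoidalCategory.associator_naturality P.p (𝟙 (𝟙_ D)) Q.p
      have idem : ((P.p ⊗ₘ 𝟙 (𝟙_ D)) ⊗ₘ Q.p) ≫ ((P.p ⊗ₘ 𝟙 (𝟙_ D)) ⊗ₘ Q.p) =
          ((P.p ⊗ₘ 𝟙 (𝟙_ D)) ⊗ₘ Q.p) := by
        simp only [tensorHom_comp_tensorHom, Karoubi.idem, Category.comp_id]
      rw [h1, h2, Category.assoc, ← reassoc_of% a, reassoc_of% idem, MonoidalCategory.triangle]))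

end KaroubiAux

/-- The Karoubian envelope: the idempotent completion of the additive envelope. -/
abbrev Kar (C : Type u) [Category.{v} C] [Preadditive C] := Idempotents.Karoubi (AddEnv C)

end Envelopes

/-! ### The data of the functor `Ω₀` -/

namespace ParZ2

open CPart MonoidalCategory

/-- The class of the partition `{{1, 1'}}` with labels `-1` on `1` and `1` on `1'`. -/
def token : CPart 1 1 := CPart.mk ⟨Partition.idn 1, Sum.elim (fun _ => -1) (fun _ => 1)⟩

variable {t : ℂ}

/-- A partition, with all labels `1`, as a morphism of `Par(ℤ₂, t)`. -/
noncomputable def ofPartition {k l : ℕ} (p : Partition k l) :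
    (⟨k⟩ : ParZ2 t) ⟶ (⟨l⟩ : ParZ2 t) :=
  (Finsupp.single (CPart.ofPartition p) 1 : CPart k l →₀ ℂ)

/-- The token of label `-1` as a morphism of `Par(ℤ₂, t)`. -/
noncomputable def tokenHom : (⟨1⟩ : ParZ2 t) ⟶ (⟨1⟩ : ParZ2 t) :=
  (Finsupp.single token 1 : CPart 1 1 →₀ ℂ)

/-- The endomorphism `e'` of `[1̃]`: half the difference of the strands with tokens `1` and `-1`. -/
noncomputable def e : (⟨1⟩ : ParZ2 t) ⟶ (⟨1⟩ : ParZ2 t) :=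
  (1 / 2 : ℂ) • (ofPartition (Partition.idn 1) - tokenHom)

/-- The tensor power `(e')^{⊗ k}`, an endomorphism of `[k̃]`. -/
noncomputable def ePow : (k : ℕ) → ((⟨k⟩ : ParZ2 t) ⟶ (⟨k⟩ : ParZ2 t))
  | 0 => 𝟙 (𝟙_ (ParZ2 t))
  | k + 1 => (ePow k ⊗ₘ e : (⟨k⟩ : ParZ2 t) ⊗ (⟨1⟩ : ParZ2 t) ⟶ (⟨k⟩ : ParZ2 t) ⊗ (⟨1⟩ : ParZ2 t))

theorem mulT_token : mulT (some (0, token)) (some (0, token)) = one 1 := by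
  classical
  apply mat_injective
  have hs : ∀ i j : Fin 1 → S, Sat token (Sum.elim i j) ↔ i = fun a => (-(j a).1, (j a).2) := by
    intro i j
    constructor
    · intro h
      funext a
      have := h (Sum.inl a) (Sum.inr a) rfl
      exact Prod.ext (by simpa [neg_eq_iff_eq_neg] using this.1) this.2
    · rintro rfl u v _
      rcases u with u | u <;> rcases v with v | v <;>
        obtain rfl := Subsingleton.elim u v <;> simp
  have hm : ∀ i j : Fin 1 → S, mat (some (0, token)) i j =
      if i = fun a => (-(j a).1, (j a).2) then 1 else 0 := by
    intro i j
    simp only [mat, Option.elim, hs, pow_zero]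
  ext i k
  rw [mat_mulT, mat_one, Matrix.mul_apply, Matrix.one_apply,
    Finset.sum_eq_single fun a => (-(k a).1, (k a).2)]
  · simp [hm]
  · intro j _ hj
    rw [hm j, if_neg hj, mul_zero]
  · simp

theorem tokenHom_tokenHom : (tokenHom ≫ tokenHom : (⟨1⟩ : ParZ2 t) ⟶ ⟨1⟩) = 𝟙 _ := by
  have h : (Finsupp.single token 1 : CPart 1 1 →₀ ℂ) = ev t (some (0, token)) := by simp [ev]
  change compL t (Finsupp.single token 1) (Finsupp.single token 1) = oneL 1
  rw [h, compL_ev, mulT_token, oneL_eq t]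

theorem e_idem : (e ≫ e : (⟨1⟩ : ParZ2 t) ⟶ ⟨1⟩) = e := by
  have h : (ofPartition (Partition.idn 1) : (⟨1⟩ : ParZ2 t) ⟶ ⟨1⟩) = 𝟙 _ := rfl
  rw [e, h]
  simp only [Linear.smul_comp, Linear.comp_smul, Preadditive.sub_comp, Preadditive.comp_sub,
    tokenHom_tokenHom, Category.id_comp, Category.comp_id]
  module

theorem ePow_idem (k : ℕ) : (ePow k ≫ ePow k : (⟨k⟩ : ParZ2 t) ⟶ ⟨k⟩) = ePow k := by
  induction k with
  | zero => exact Category.id_comp _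
  | succ k ih =>
    refine (tensorHom_comp_tensorHom (ePow k) e (ePow k) e).trans ?_
    rw [ih, e_idem]
    rfl

/-- The object `([k̃], (e')^{⊗ k})` of the Karoubian envelope of `Par(ℤ₂, t)`. -/
noncomputable def karObj (t : ℂ) (k : ℕ) : Kar (ParZ2 t) where
  X := AddEnv.ι.obj ⟨k⟩
  p := AddEnv.ι.map (ePow k)
  idem := by rw [← Functor.map_comp, ePow_idem]

/-- The morphism `(e')^{⊗ l} ∘ g ∘ (e')^{⊗ k}` from `([k̃], (e')^{⊗ k})` to
`([l̃], (e')^{⊗ l})`. -/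
noncomputable def karHom {k l : ℕ} (g : (⟨k⟩ : ParZ2 t) ⟶ ⟨l⟩) : karObj t k ⟶ karObj t l where
  f := AddEnv.ι.map (ePow k ≫ g ≫ ePow l)
  comm := by
    dsimp only [karObj]
    rw [← Functor.map_comp, ← Functor.map_comp]
    congr 1
    simp only [Category.assoc, ePow_idem]
    rw [← Category.assoc, ePow_idem]

end ParZ2

/-- For a partition with blocks of sizes `m₁, …, mₛ`, the number `2 ^ ((∑ mᵢ - 2 s) / 2)`. -/
noncomputable def Partition.coeff {k l : ℕ} (p : Partition k l) : ℝ :=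
  (2 : ℝ) ^ (((∑ᶠ B ∈ p.classes, (B.ncard : ℝ)) - 2 * (p.classes.ncard : ℝ)) / 2)

/-- An even partition as a morphism of `Rep₀(H_t)`. -/
noncomputable def RepZero.ofEven {t : ℂ} {k l : ℕ} (f : EvenPart k l) :
    (⟨k⟩ : RepZero t) ⟶ (⟨l⟩ : RepZero t) :=
  (Finsupp.single f 1 : EvenPart k l →₀ ℂ)

open MonoidalCategory in
/-- A monoidal functor is strict if `F 1 = 1` and `F X ⊗ F Y = F (X ⊗ Y)`, and the structure
morphisms are the identities. -/
structure IsStrict {C D : Type*} [Category* C] [Category* D] [MonoidalCategory C]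
    [MonoidalCategory D] (F : C ⥤ D) [F.Monoidal] : Prop where
  unit : ∃ h : 𝟙_ D = F.obj (𝟙_ C), Functor.LaxMonoidal.ε F = eqToHom h
  tensor : ∀ X Y : C, ∃ h : F.obj X ⊗ F.obj Y = F.obj (X ⊗ Y),
    Functor.LaxMonoidal.μ F X Y = eqToHom h

end Interpolation

/-! Only compatibility with composition is a real computation; it rests on averaging over signs.
Expanding the tensor power gives $(e')^{\otimes l} = 2^{-l}\sum_z \mathrm{sgn}(z)\,\tau_z$, where
$z$ runs over sign vectors of length $l$ and $\tau_z$ is the bundle of $l$ strands carrying the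
tokens $z$ (`ePow_eq`). Hence $\tau_w$ is absorbed by $(e')^{\otimes l}$ on either side at the cost
of the factor $\mathrm{sgn}(w)$.

For even $p \in P(k,l)$ and $q \in P(l,m)$, the middle idempotent in $(e')^{\otimes m} q
(e')^{\otimes l} p (e')^{\otimes k}$ is expanded in this way. Let $M$ be the group of those $z$ that
are products, on the middle row, of a sign function $b$ constant on the blocks of $p$ and a sign
function $a$ constant on the blocks of $q$. If $z \notin M$, the stacked coloured partitions are
incompatible and the summand vanishes. If $z \in M$, the tokens slide through $p$ and $q$ to the
outer rows, where the outer idempotents turn them into signs. Since blocks are even, the product of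
$b$ over all vertices is $1$, and likewise for $a$; so these signs cancel $\mathrm{sgn}(z)$, and
every $z \in M$ contributes the same morphism. At parameter $2t$ the composite is therefore
$2^{-l}|M|(2t)^{l(q,p)}$ times $(e')^{\otimes m}(q \star p)(e')^{\otimes k}$
(`ePow_comp_ePow_comp_ePow`).

It remains to count. Write $|r|$ for the number of blocks of $r$. Pairs $(b,a)$ that multiply to $1$
on the middle row are the sign functions on the connected components of the stacking, and these
components are the blocks of $q \star p$ together with the loops. So $|M| = 2^{|p|+|q|-|q\star
p|-l(q,p)}$ (`card_middleSigns`). The prescribed coefficient of $p$ equals $2^{(k+l)/2-|p|}$, and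
the powers of $2$ balance exactly (`coeff_mul_coeff`): the $2$ in the parameter $2t$ pays for the
loops, leaving $t^{l(q,p)}$.

Tensor products are easier, since block numbers add and $(e')^{\otimes k}\otimes(e')^{\otimes l} =
(e')^{\otimes (k+l)}$. Strictness then requires equalities of objects in the Karoubian envelope.
Morphisms between the objects concerned are compared through representatives in
$\mathrm{Par}(\mathbb Z_2,2t)$ (`IsImage`), where every coherence condition collapses to
idempotency. -/

namespace Interpolation

/-! ### Sign functions that are constant on blocks -/

/-- The group of functions to `ℤ₂` that are constant on the classes of an equivalence relation. -/
def blockSigns {V : Type*} (r : Setoid V) : Subgroup (V → ℤˣ) where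
  carrier := {b | ∀ u v, r u v → b u = b v}
  one_mem' := fun _ _ _ => rfl
  mul_mem' := fun {a b} ha hb u v h => by simp only [Pi.mul_apply, ha u v h, hb u v h]
  inv_mem' := fun {a} ha u v h => by simp only [Pi.inv_apply, ha u v h]

/-- Functions constant on classes are the functions on the quotient. -/
def blockSignsEquiv {V : Type*} (r : Setoid V) : blockSigns r ≃ (Quotient r → ℤˣ) where
  toFun b := Quotient.lift b.1 b.2
  invFun g := ⟨fun u => g (Quotient.mk r u), fun _ _ h => congrArg g (Quotient.sound h)⟩
  left_inv _ := rfl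
  right_inv g := by
    funext q
    induction q using Quotient.inductionOn
    rfl

theorem card_blockSigns {V : Type*} [Finite V] (r : Setoid V) :
    Nat.card (blockSigns r) = 2 ^ Nat.card (Quotient r) := by
  rw [Nat.card_congr (blockSignsEquiv r), Nat.card_fun, Nat.card_eq_fintype_card (α := ℤˣ)]
  rfl

namespace Partition

variable {k l m k' l' : ℕ}

/-- The set where `b` is $-1$ is a union of blocks, hence has even cardinality. This is how evenness
enters the cancellation of signs. -/
theorem IsEven.prod_eq_one {p : Partition k l} (hp : p.IsEven) {b : Fin k ⊕ Fin l → ℤˣ}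
    (hb : b ∈ blockSigns p) : ∏ u, b u = 1 := by
  classical
  have h := hp.ncard_of_closed {u | b u = -1} fun u v huv hu => (hb u v huv).symm.trans hu
  have h1 : ∀ u, b u = if b u = -1 then -1 else 1 := by
    intro u
    rcases Int.units_eq_one_or (b u) with h | h <;> simp [h]
  rw [Set.ncard_eq_toFinset_card', Set.toFinset_ofPred] at h
  rw [Finset.prod_congr rfl fun u _ => h1 u, Finset.prod_ite, Finset.prod_const,
    Finset.prod_const_one, mul_one, h.neg_one_pow]

/-! ### The normalising coefficient in terms of the number of blocks -/

/-- Blocks partition the $k+l$ vertices, so their sizes sum to $k+l$. Multiplicativity thus becomes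
a question of counting blocks only. -/
theorem coeff_eq (p : Partition k l) :
    p.coeff = (2 : ℝ) ^ (((k + l : ℕ) : ℝ) / 2 - Nat.card (Quotient p)) := by
  have h1 : p.classes.ncard = Nat.card (Quotient p) :=
    (Nat.card_congr p.quotientEquivClasses).symm
  have h2 : ∑ᶠ B ∈ p.classes, (B.ncard : ℝ) = ((k + l : ℕ) : ℝ) := by
    have h3 := p.isPartition_classes.ncard_eq_finsum (s := Set.univ)
    simp only [Set.univ_inter] at h3
    rw [Set.ncard_univ, Nat.card_sum, Nat.card_fin, Nat.card_fin,
      finsum_set_coe_eq_finsum_mem (f := fun B : Set (Fin k ⊕ Fin l) => B.ncard)] at h3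
    rw [h3]
    exact ((Nat.castAddMonoidHom ℝ).map_finsum_mem _ (Set.toFinite _)).symm
  rw [coeff, h1, h2]
  congr 1
  ring

theorem coeff_idn (n : ℕ) : (idn n).coeff = 1 := by
  have h : Nat.card (Quotient (idn n)) = n := by
    rw [Nat.card_congr (Setoid.quotientKerEquivOfSurjective (Sum.elim id id)
      fun a => ⟨Sum.inl a, rfl⟩), Nat.card_fin]
  rw [coeff_eq, h]
  push_cast
  rw [add_self_div_two, sub_self, Real.rpow_zero]

/-- No block of a horizontal concatenation meets both halves, so its blocks form the disjoint union
of those of the two diagrams. -/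
theorem card_quotient_tens (p : Partition k l) (q : Partition k' l') :
    Nat.card (Quotient (p.tens q)) = Nat.card (Quotient p) + Nat.card (Quotient q) := by
  have hl : ∀ u v, p u v → p.tens q (CPart.left k l k' l' u) (CPart.left k l k' l' v) := by
    intro u v h
    change Sum.LiftRel _ _ _ _
    rw [CPart.split_left, CPart.split_left]
    exact Sum.LiftRel.inl h
  have hr : ∀ u v, q u v → p.tens q (CPart.right k l k' l' u) (CPart.right k l k' l' v) := by
    intro u v h
    change Sum.LiftRel _ _ _ _
    rw [CPart.split_right, CPart.split_right]
    exact Sum.LiftRel.inr h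
  let φ : Quotient p ⊕ Quotient q → Quotient (p.tens q) :=
    Sum.elim (Quotient.map _ fun u v => hl u v) (Quotient.map _ fun u v => hr u v)
  have hφ : Function.Bijective φ := by
    constructor
    · rintro (a | a) (b | b) h <;> induction a using Quotient.inductionOn <;>
        induction b using Quotient.inductionOn <;>
        (have h' : Sum.LiftRel _ _ _ _ := Quotient.exact h) <;>
        simp only [CPart.split_left, CPart.split_right, Sum.liftRel_inl_inl,
          Sum.liftRel_inr_inr, Sum.not_liftRel_inl_inr, Sum.not_liftRel_inr_inl] at h'
      · exact congrArg Sum.inl (Quotient.sound h')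
      · exact congrArg Sum.inr (Quotient.sound h')
    · intro c
      induction c using Quotient.inductionOn with | _ w =>
      rcases CPart.left_or_right w with ⟨u, rfl⟩ | ⟨u, rfl⟩
      · exact ⟨Sum.inl (Quotient.mk _ u), rfl⟩
      · exact ⟨Sum.inr (Quotient.mk _ u), rfl⟩
  rw [← Nat.card_congr (Equiv.ofBijective φ hφ), Nat.card_sum]

theorem coeff_tens (p : Partition k l) (q : Partition k' l') :
    (p.tens q).coeff = p.coeff * q.coeff := by
  rw [coeff_eq, coeff_eq, coeff_eq, card_quotient_tens, ← Real.rpow_add two_pos]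
  congr 1
  push_cast
  ring

/-! ### Counting the middle labels -/

/-- A component of the stacking either meets an outer row, and then restricts to exactly one block
of the composite, or lies in the middle row and is a loop. -/
theorem card_quotient_stack (p : Partition k l) (q : Partition l m) :
    Nat.card (Quotient (p.stack q)) = Nat.card (Quotient (p.vcomp q)) + p.loops q := by
  classical
  let R : Set (Quotient (p.stack q)) := Set.range (Quotient.mk'' ∘ outer)
  have h1 : Nat.card (Quotient (p.vcomp q)) = Nat.card R :=
    Nat.card_congr (Setoid.comapQuotientEquiv outer (p.stack q))
  have h2 : p.loops q = Nat.card {c // c ∉ R} := by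
    refine Nat.card_congr (Equiv.subtypeEquivRight fun c => ⟨?_, fun hc u hu => ?_⟩)
    · rintro h ⟨u, hu⟩
      obtain ⟨j, hj⟩ := h _ hu
      cases u <;> simp [outer] at hj
    · rcases u with u | u | u
      · exact absurd ⟨Sum.inl u, hu⟩ hc
      · exact ⟨u, rfl⟩
      · exact absurd ⟨Sum.inr u, hu⟩ hc
  rw [h1, h2, ← Nat.card_sum]
  exact Nat.card_congr (Equiv.sumCompl (· ∈ R)).symm

/-- The labels of the middle row obtained from two functions constant on blocks. -/
def middleHom (p : Partition k l) (q : Partition l m) :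
    blockSigns p × blockSigns q →* (Fin l → ℤˣ) where
  toFun x i := x.1.1 (Sum.inr i) * x.2.1 (Sum.inl i)
  map_one' := rfl
  map_mul' _ _ := funext fun _ => mul_mul_mul_comm _ _ _ _

/-- The labels of the middle row for which two stacked partitions are compatible. -/
def middleSigns (p : Partition k l) (q : Partition l m) : Subgroup (Fin l → ℤˣ) :=
  (middleHom p q).range

theorem mem_middleSigns {p : Partition k l} {q : Partition l m} {z : Fin l → ℤˣ} :
    z ∈ middleSigns p q ↔ ∃ b ∈ blockSigns p, ∃ a ∈ blockSigns q,
      z = fun i => b (Sum.inr i) * a (Sum.inl i) := by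
  constructor
  · rintro ⟨⟨b, a⟩, rfl⟩
    exact ⟨b.1, b.2, a.1, a.2, rfl⟩
  · rintro ⟨b, hb, a, ha, rfl⟩
    exact ⟨(⟨b, hb⟩, ⟨a, ha⟩), rfl⟩

/-- Functions constant on the components of a stacking, as pairs of functions constant on the blocks
of the two partitions that agree in the middle row. -/
def stackSignsEquiv (p : Partition k l) (q : Partition l m) :
    blockSigns (p.stack q) ≃ (middleHom p q).ker where
  toFun c := ⟨(⟨fun u => c.1 (low u), fun _ _ h => c.2 _ _ (.rel _ _ (.low h))⟩,
    ⟨fun u => c.1 (high u), fun _ _ h => c.2 _ _ (.rel _ _ (.high h))⟩),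
    -- Both restrictions take the same value at a middle vertex, so their product there is a square,
    -- that is, $1$.
    funext fun _ => Int.units_mul_self _⟩
  invFun x := ⟨Sum.elim (fun i => x.1.1.1 (Sum.inl i)) x.1.2.1, by
    obtain ⟨⟨⟨b, hb⟩, ⟨a, ha⟩⟩, hx⟩ := x
    -- Lying in the kernel means that `b` and `a` are mutually inverse on the middle row; since
    -- signs are involutions they agree there and can be glued.
    have hab : ∀ i, b (Sum.inr i) = a (Sum.inl i) := fun i => by
      have := congrFun hx i
      rwa [← Int.units_inv_eq_self (a _), ← mul_eq_one_iff_eq_inv]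
    have hlow : ∀ u, Sum.elim (fun i => b (Sum.inl i)) a (low u) = b u := by
      rintro (u | u)
      · rfl
      · exact (hab u).symm
    intro u v h
    induction h with
    | rel u v h =>
      cases h with
      | low h => exact (hlow _).trans ((hb _ _ h).trans (hlow _).symm)
      | high h => exact ha _ _ h
    | refl => rfl
    | symm _ _ _ ih => exact ih.symm
    | trans _ _ _ _ _ ih ih' => exact ih.trans ih'⟩
  left_inv c := by
    refine Subtype.ext (funext fun u => ?_)
    rcases u with u | u <;> rfl
  right_inv x := by
    obtain ⟨⟨⟨b, hb⟩, ⟨a, ha⟩⟩, hx⟩ := x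
    have hab : ∀ i, b (Sum.inr i) = a (Sum.inl i) := fun i => by
      have := congrFun hx i
      rwa [← Int.units_inv_eq_self (a _), ← mul_eq_one_iff_eq_inv]
    refine Subtype.ext (Prod.ext (Subtype.ext (funext fun u => ?_)) rfl)
    rcases u with u | u
    · rfl
    · exact (hab u).symm

/-- First isomorphism theorem for `middleHom`: the order of the range times the order of the kernel
is the order of the source. The kernel has one free sign per component of the stacking, the source
one per block of `p` and of `q`. -/
theorem card_middleSigns (p : Partition k l) (q : Partition l m) :
    Nat.card (middleSigns p q) * 2 ^ (Nat.card (Quotient (p.vcomp q)) + p.loops q) =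
      2 ^ (Nat.card (Quotient p) + Nat.card (Quotient q)) := by
  rw [← card_quotient_stack, ← card_blockSigns, Nat.card_congr (stackSignsEquiv p q), middleSigns,
    ← Subgroup.index_ker, mul_comm, Subgroup.card_mul_index, Nat.card_prod, card_blockSigns,
    card_blockSigns, pow_add]

/-- After inserting the count of middle labels, everything is a power of $2$ and the exponents
agree: block numbers of `p` and `q` and the loops cancel, and the middle row, counted in both
coefficients, gives $l/2+l/2=l$. -/
theorem coeff_mul_coeff (p : Partition k l) (q : Partition l m) :
    p.coeff * q.coeff * 2 ^ p.loops q * Nat.card (middleSigns p q) = 2 ^ l * (p.vcomp q).coeff := by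
  have h := congrArg (Nat.cast (R := ℝ)) (card_middleSigns p q)
  push_cast at h
  have h0 : (0 : ℝ) < 2 ^ (Nat.card (Quotient (p.vcomp q)) + p.loops q) := by positivity
  rw [← eq_div_iff h0.ne'] at h
  rw [h, coeff_eq, coeff_eq, coeff_eq]
  simp only [← Real.rpow_natCast]
  rw [← Real.rpow_sub two_pos, ← Real.rpow_add two_pos, ← Real.rpow_add two_pos,
    ← Real.rpow_add two_pos, ← Real.rpow_add two_pos]
  congr 1
  push_cast
  ring

end Partition

namespace CPart

variable {n k l m k' l' : ℕ}

/-! ### Strands with tokens -/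

/-- The identity partition with labels `z` on the lower row and `1` on the upper row. -/
def tokens (z : Fin n → ℤˣ) : Term n n :=
  some (0, mk ⟨Partition.idn n, Sum.elim z 1⟩)

/-- A partition as a term. -/
def partT (p : Partition k l) : Term k l := some (0, ofPartition p)

/-- Multiplication of the states of a row by signs. -/
def signed (z : Fin n → ℤˣ) (i : Fin n → S) : Fin n → S := fun a => (z a * (i a).1, (i a).2)

theorem signed_signed (z : Fin n → ℤˣ) (i : Fin n → S) : signed z (signed z i) = i := by
  funext a
  simp only [signed, ← mul_assoc, Int.units_mul_self, one_mul]

open Classical in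
-- Tokens act on states by the permutation `signed z`. Through `mat_injective`, identities between
-- diagrams with tokens become substitutions in the row and column indices.
theorem mat_tokens (z : Fin n → ℤˣ) (i j : Fin n → S) :
    mat (tokens z) i j = if j = signed z i then 1 else 0 := by
  have h : Sat (mk ⟨Partition.idn n, Sum.elim z 1⟩) (Sum.elim i j) ↔ j = signed z i := by
    constructor
    · intro h
      funext a
      have := h (Sum.inl a) (Sum.inr a) rfl
      exact Prod.ext (by simpa [signed] using this.1.symm) this.2.symm
    · rintro rfl u v huv
      have h : ∀ w, (Sum.elim z 1 w : ℤˣ) * (Sum.elim i (signed z i) w).1 =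
          z (Sum.elim id id w) * (i (Sum.elim id id w)).1 ∧
          (Sum.elim i (signed z i) w).2 = (i (Sum.elim id id w)).2 := by
        rintro (w | w) <;> simp [signed]
      have huv : Sum.elim id id u = Sum.elim id id v := huv
      rw [(h u).1, (h v).1, (h u).2, (h v).2, huv]
      exact ⟨rfl, rfl⟩
  simp only [tokens, mat, Option.elim, h, pow_zero]

theorem mat_tokens_mulT (z : Fin k → ℤˣ) (A : Term k l) (i j) :
    mat (mulT (tokens z) A) i j = mat A (signed z i) j := by
  rw [mat_mulT, Matrix.mul_apply, Finset.sum_eq_single (signed z i)]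
  · simp [mat_tokens]
  · intro b _ hb
    rw [mat_tokens, if_neg hb, zero_mul]
  · simp

theorem mat_mulT_tokens (A : Term k l) (z : Fin l → ℤˣ) (i j) :
    mat (mulT A (tokens z)) i j = mat A i (signed z j) := by
  rw [mat_mulT, Matrix.mul_apply, Finset.sum_eq_single (signed z j)]
  · simp [mat_tokens, signed_signed]
  · intro b _ hb
    rw [mat_tokens, if_neg, mul_zero]
    rintro rfl
    exact hb (signed_signed z b).symm
  · simp

theorem tokens_one : tokens (1 : Fin n → ℤˣ) = one n := by
  refine congrArg some (congrArg (Prod.mk 0) (congrArg mk (congrArg (ColouredDiagram.mk _) ?_)))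
  funext u
  rcases u with u | u <;> rfl

theorem tokens_mul (z w : Fin n → ℤˣ) : mulT (tokens z) (tokens w) = tokens (z * w) := by
  classical
  apply mat_injective
  ext i j
  rw [mat_tokens_mulT, mat_tokens, mat_tokens]
  have : signed w (signed z i) = signed (z * w) i := by
    funext a
    simp only [signed, Pi.mul_apply, mul_left_comm, mul_assoc]
  rw [this]

theorem tensT_tokens (z : Fin k → ℤˣ) (w : Fin l → ℤˣ) :
    tensT (tokens z) (tokens w) = tokens (Fin.append z w) := by
  classical
  apply mat_injective
  ext i j
  have h : j = signed (Fin.append z w) i ↔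
      (fun a => j (Fin.castAdd l a)) = signed z (fun a => i (Fin.castAdd l a)) ∧
      (fun a => j (Fin.natAdd k a)) = signed w (fun a => i (Fin.natAdd k a)) := by
    simp only [funext_iff, signed, Fin.forall_fin_add, Fin.append_left, Fin.append_right]
  rw [mat_tensT, mat_tokens, mat_tokens, mat_tokens, if_congr h rfl rfl, ite_and]
  split_ifs <;> rfl

/-! ### Sliding tokens through a partition -/

theorem sat_ofPartition (p : Partition k l) (f : Fin k ⊕ Fin l → S) :
    Sat (ofPartition p) f ↔ ∀ u v, p u v → f u = f v := by
  refine forall_congr' fun u => forall_congr' fun v => imp_congr_right fun _ => ?_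
  simp [Prod.ext_iff]

theorem mat_partT_ne_zero {p : Partition k l} {i j} (h : mat (partT p) i j ≠ 0) :
    Sat (ofPartition p) (Sum.elim i j) := by
  by_contra h'
  simp [partT, mat, h'] at h

theorem mulT_partT (p : Partition k l) (q : Partition l m) :
    mulT (partT p) (partT q) = some (p.loops q, ofPartition (p.vcomp q)) := by
  simp only [mulT, partT, Option.bind_some, vcomp_ofPartition, Option.map_some, zero_add]
  rfl

theorem tensT_partT (p : Partition k l) (q : Partition k' l') :
    tensT (partT p) (partT q) = partT (p.tens q) := by
  simp only [tensT, partT, Option.bind_some, Option.map_some, tens_ofPartition, zero_add]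

/-- Signs that are constant on blocks can be cancelled. -/
theorem tokens_partT_tokens {p : Partition k l} {b : Fin k ⊕ Fin l → ℤˣ}
    (hb : b ∈ blockSigns p) :
    mulT (tokens fun i => b (Sum.inl i)) (mulT (partT p) (tokens fun j => b (Sum.inr j))) =
      partT p := by
  apply mat_injective
  ext i j
  rw [mat_tokens_mulT, mat_mulT_tokens]
  -- The signs `b` change a state by a common factor on each block, which does not affect whether it
  -- is constant on blocks.
  have h : Sat (ofPartition p) (Sum.elim (signed (fun i => b (Sum.inl i)) i)
      (signed (fun j => b (Sum.inr j)) j)) ↔ Sat (ofPartition p) (Sum.elim i j) := by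
    rw [sat_ofPartition, sat_ofPartition]
    refine forall_congr' fun u => forall_congr' fun v => imp_congr_right fun huv => ?_
    have h1 : ∀ w, Sum.elim (signed (fun i => b (Sum.inl i)) i)
        (signed (fun j => b (Sum.inr j)) j) w =
        (b w * (Sum.elim i j w).1, (Sum.elim i j w).2) := by
      rintro (w | w) <;> rfl
    rw [h1, h1, hb u v huv, Prod.ext_iff, Prod.ext_iff, mul_right_inj]
  simp only [partT, mat, Option.elim]
  classical exact if_congr h rfl rfl

theorem tokens_mul_self (z : Fin n → ℤˣ) : mulT (tokens z) (tokens z) = one n := by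
  rw [tokens_mul, ← tokens_one]
  congr 1
  exact funext fun _ => Int.units_mul_self _

/-- Tokens are their own inverses, so cancelling signs on both rows amounts to carrying them from
the upper to the lower row. -/
theorem partT_mul_tokens {p : Partition k l} {b : Fin k ⊕ Fin l → ℤˣ}
    (hb : b ∈ blockSigns p) :
    mulT (partT p) (tokens fun j => b (Sum.inr j)) =
      mulT (tokens fun i => b (Sum.inl i)) (partT p) := by
  conv_rhs => rw [← tokens_partT_tokens hb]
  rw [← mulT_assoc, tokens_mul_self, one_mulT]

theorem tokens_mul_partT {p : Partition k l} {b : Fin k ⊕ Fin l → ℤˣ}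
    (hb : b ∈ blockSigns p) :
    mulT (tokens fun i => b (Sum.inl i)) (partT p) =
      mulT (partT p) (tokens fun j => b (Sum.inr j)) := (partT_mul_tokens hb).symm

/-- The tokens between two partitions can be moved to the outer rows. -/
theorem partT_tokens_partT {p : Partition k l} {q : Partition l m}
    {b : Fin k ⊕ Fin l → ℤˣ} (hb : b ∈ blockSigns p)
    {a : Fin l ⊕ Fin m → ℤˣ} (ha : a ∈ blockSigns q) :
    mulT (partT p) (mulT (tokens fun i => b (Sum.inr i) * a (Sum.inl i)) (partT q)) =
      mulT (tokens fun i => b (Sum.inl i))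
        (mulT (mulT (partT p) (partT q)) (tokens fun i => a (Sum.inr i))) := by
  have h : (fun i => b (Sum.inr i) * a (Sum.inl i)) =
      (fun i => b (Sum.inr i)) * fun i => a (Sum.inl i) := rfl
  -- The middle tokens are split into two factors: `a` moves up through `q`, and `b` moves down
  -- through `p`.
  rw [h, ← tokens_mul, mulT_assoc, tokens_mul_partT ha, ← mulT_assoc, partT_mul_tokens hb]
  simp only [mulT_assoc]

/-- A composite that is not `none` has a nonzero matrix entry, hence an intermediate state `j`
admissible for both factors. The sign components of the two admissible states are constant on blocks
and exhibit `z` as a middle label. -/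
theorem partT_tokens_partT_eq_none {p : Partition k l} {q : Partition l m} {z : Fin l → ℤˣ}
    (hz : z ∉ Partition.middleSigns p q) :
    mulT (partT p) (mulT (tokens z) (partT q)) = none := by
  classical
  rw [Option.eq_none_iff_forall_ne_some]
  intro A hA
  obtain ⟨f, hf⟩ := exists_sat A.2
  have h0 : mat (some A) (fun i => f (Sum.inl i)) (fun i => f (Sum.inr i)) ≠ 0 := by
    have : Sum.elim (fun i => f (Sum.inl i)) (fun i => f (Sum.inr i)) = f :=
      Sum.elim_comp_inl_inr f
    simp only [mat, Option.elim, this, if_pos hf]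
    positivity
  rw [← hA, mat_mulT, Matrix.mul_apply] at h0
  obtain ⟨j, -, hj⟩ := Finset.exists_ne_zero_of_sum_ne_zero h0
  rw [mat_tokens_mulT] at hj
  have h1 := (sat_ofPartition _ _).1 (mat_partT_ne_zero (left_ne_zero_of_mul hj))
  have h2 := (sat_ofPartition _ _).1 (mat_partT_ne_zero (right_ne_zero_of_mul hj))
  refine hz (Partition.mem_middleSigns.2 ⟨_, fun u v huv => congrArg Prod.fst (h1 u v huv),
    _, fun u v huv => congrArg Prod.fst (h2 u v huv), funext fun i => ?_⟩)
  -- At a middle vertex the state for `p` has the sign of `j`, and the state for `q` has that sign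
  -- times `z`; the product is `z`.
  simp only [Sum.elim_inr, Sum.elim_inl, signed]
  rw [mul_left_comm, Int.units_mul_self, mul_one]

end CPart

namespace ParZ2

open CPart MonoidalCategory

variable {n k l m k' l' : ℕ} {t : ℂ}

/-! ### The idempotent as an alternating sum -/

/-- A term as a morphism. -/
noncomputable def ofTerm (t : ℂ) (A : Term k l) : (⟨k⟩ : ParZ2 t) ⟶ ⟨l⟩ := ev t A

theorem ofTerm_comp (A : Term k l) (B : Term l m) :
    ofTerm t A ≫ ofTerm t B = ofTerm t (mulT A B) := compL_ev t A B

theorem ofTerm_tensor (A : Term k l) (B : Term k' l') :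
    ofTerm t A ⊗ₘ ofTerm t B = ofTerm t (tensT A B) := tensL_ev t A B

theorem ofTerm_one : ofTerm t (one n) = 𝟙 _ := (oneL_eq t n).symm

theorem ofTerm_none : ofTerm t (none : Term k l) = 0 := rfl

theorem ofTerm_some (a : ℕ) (p : Partition k l) :
    ofTerm t (some (a, CPart.ofPartition p)) = t ^ a • ofPartition p := by
  refine Eq.trans ?_ (Finsupp.smul_single (t ^ a) (CPart.ofPartition p) (1 : ℂ)).symm
  rw [smul_eq_mul, mul_one]
  rfl

theorem ofTerm_partT (p : Partition k l) : ofTerm t (partT p) = ofPartition p := by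
  rw [partT, ofTerm_some, pow_zero, one_smul]

theorem ofPartition_tensor (p : Partition k l) (q : Partition k' l') :
    (ofPartition p ⊗ₘ ofPartition q : (⟨k⟩ ⊗ ⟨k'⟩ : ParZ2 t) ⟶ ⟨l⟩ ⊗ ⟨l'⟩) =
      ofPartition (p.tens q) := by
  rw [← ofTerm_partT, ← ofTerm_partT, ofTerm_tensor, tensT_partT, ofTerm_partT]

/-- The product of signs, as a complex number. -/
def sgn (z : Fin n → ℤˣ) : ℂ := ((∏ i, z i : ℤˣ) : ℤ)

theorem sgn_mul (z w : Fin n → ℤˣ) : sgn (z * w) = sgn z * sgn w := by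
  simp [sgn, Finset.prod_mul_distrib]

theorem sgn_mul_self (z : Fin n → ℤˣ) : sgn z * sgn z = 1 := by
  rw [← sgn_mul, show z * z = 1 from funext fun _ => Int.units_mul_self _]
  simp [sgn]

theorem sgn_append (z : Fin k → ℤˣ) (w : Fin l → ℤˣ) :
    sgn (Fin.append z w) = sgn z * sgn w := by
  simp [sgn, Fin.prod_univ_add]

theorem e_eq : (e : (⟨1⟩ : ParZ2 t) ⟶ ⟨1⟩) =
    (1 / 2 : ℂ) • ∑ z : Fin 1 → ℤˣ, sgn z • ofTerm t (tokens z) := by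
  have h1 : ofTerm t (tokens (1 : Fin 1 → ℤˣ)) = ofPartition (Partition.idn 1) := by
    rw [tokens_one]
    exact ofTerm_partT _
  have h2 : ofTerm t (tokens (fun _ : Fin 1 => (-1 : ℤˣ))) = tokenHom := by
    refine (congrArg (Finsupp.single _) (pow_zero t) : _)
  have hu : (Finset.univ : Finset ℤˣ) = {1, -1} := rfl
  rw [e, ← (Equiv.funUnique (Fin 1) ℤˣ).symm.sum_comp, hu, Finset.sum_pair (by decide)]
  change _ = (1 / 2 : ℂ) • (sgn (1 : Fin 1 → ℤˣ) • ofTerm t (tokens (1 : Fin 1 → ℤˣ)) +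
    sgn (fun _ : Fin 1 => (-1 : ℤˣ)) • ofTerm t (tokens (fun _ : Fin 1 => (-1 : ℤˣ))))
  rw [h1, h2]
  simp [sgn, sub_eq_add_neg]

/-- This is the idempotent of the group $\mathbb Z_2^k$, acting by tokens, for the character `sgn`.
In the induction, tensoring concatenates sign vectors and multiplies their signs. -/
theorem ePow_eq (k : ℕ) : (ePow k : (⟨k⟩ : ParZ2 t) ⟶ ⟨k⟩) =
    (1 / 2 : ℂ) ^ k • ∑ z : Fin k → ℤˣ, sgn z • ofTerm t (tokens z) := by
  induction k with
  | zero =>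
    have h : sgn (1 : Fin 0 → ℤˣ) = 1 := by simp [sgn]
    rw [Fintype.sum_subsingleton _ (1 : Fin 0 → ℤˣ), pow_zero, one_smul, h, one_smul,
      tokens_one, ofTerm_one]
    rfl
  | succ k ih =>
    change (ePow k ⊗ₘ e : (⟨k⟩ : ParZ2 t) ⊗ (⟨1⟩ : ParZ2 t) ⟶ _) = _
    rw [ih, e_eq, smul_tensor', tensor_smul', sum_tensor, smul_smul, ← pow_succ]
    congr 1
    rw [← (Fin.appendEquiv k 1 (α := ℤˣ)).sum_comp, Fintype.sum_prod_type]
    refine Finset.sum_congr rfl fun z _ => ?_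
    rw [tensor_sum]
    refine Finset.sum_congr rfl fun w _ => ?_
    rw [smul_tensor', tensor_smul', smul_smul, ofTerm_tensor, tensT_tokens, ← sgn_append]
    rfl

/-- Translation by `w` permutes the summands of the average, and `sgn` is a character with values
$\pm 1$. -/
theorem tokens_comp_ePow (w : Fin k → ℤˣ) :
    ofTerm t (tokens w) ≫ ePow k = sgn w • ePow k := by
  rw [ePow_eq, Linear.comp_smul, Preadditive.comp_sum, smul_comm]
  congr 1
  rw [Finset.smul_sum, ← Equiv.sum_comp (Equiv.mulLeft w)]
  refine Finset.sum_congr rfl fun z _ => ?_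
  rw [Equiv.coe_mulLeft, sgn_mul, Linear.comp_smul, ofTerm_comp, tokens_mul, ← mul_assoc,
    show w * w = 1 from funext fun _ => Int.units_mul_self _, one_mul, smul_smul]

theorem ePow_comp_tokens (w : Fin k → ℤˣ) :
    ePow k ≫ ofTerm t (tokens w) = sgn w • ePow k := by
  rw [ePow_eq, Linear.smul_comp, Preadditive.sum_comp, smul_comm]
  congr 1
  rw [Finset.smul_sum, ← Equiv.sum_comp (Equiv.mulRight w)]
  refine Finset.sum_congr rfl fun z _ => ?_
  rw [Equiv.coe_mulRight, sgn_mul, Linear.smul_comp, ofTerm_comp, tokens_mul, mul_assoc,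
    show w * w = 1 from funext fun _ => Int.units_mul_self _, mul_one, smul_smul, mul_comm]

/-- The contribution of one choice of tokens in the middle row. -/
theorem ePow_partT_tokens_partT_ePow {p : Partition k l} {q : Partition l m} (hp : p.IsEven)
    (hq : q.IsEven) {z : Fin l → ℤˣ} (hz : z ∈ Partition.middleSigns p q) :
    sgn z • (ePow k ≫ ofTerm t (mulT (partT p) (mulT (tokens z) (partT q))) ≫ ePow m) =
      t ^ p.loops q • (ePow k ≫ ofPartition (p.vcomp q) ≫ ePow m) := by
  obtain ⟨b, hb, a, ha, rfl⟩ := Partition.mem_middleSigns.1 hz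
  -- By evenness the total product of `b` is $1$, so its products over the two rows coincide; the
  -- same holds for `a`. Thus the sign of the middle tokens equals that of the tokens moved outside.
  have hs : sgn (fun i => b (Sum.inr i) * a (Sum.inl i)) =
      sgn (fun i => b (Sum.inl i)) * sgn (fun i => a (Sum.inr i)) := by
    have h1 := hp.prod_eq_one hb
    have h2 := hq.prod_eq_one ha
    rw [Fintype.prod_sum_type, mul_eq_one_iff_eq_inv, Int.units_inv_eq_self] at h1 h2
    rw [show (fun i => b (Sum.inr i) * a (Sum.inl i)) =
      (fun i => b (Sum.inr i)) * fun i => a (Sum.inl i) from rfl, sgn_mul]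
    simp only [sgn, h1, h2]
  rw [partT_tokens_partT hb ha, mulT_partT, ← ofTerm_comp, ← ofTerm_comp, ofTerm_some,
    Category.assoc, Category.assoc, tokens_comp_ePow, ← Category.assoc, ePow_comp_tokens, hs]
  simp only [Linear.smul_comp, Linear.comp_smul, smul_smul]
  congr 1
  -- Each outer sign now occurs twice, once from the alternating sum and once from absorption, and
  -- squares to $1$.
  linear_combination (t ^ p.loops q * sgn (fun i => b (Sum.inl i)) *
    sgn (fun i => b (Sum.inl i))) * sgn_mul_self (fun i => a (Sum.inr i)) +
    t ^ p.loops q * sgn_mul_self (fun i => b (Sum.inl i))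

/-- Expanding the middle idempotent leaves one identical contribution for each element of
`middleSigns p q` and zero for every other sign vector, so the sum is a count. -/
theorem ePow_comp_ePow_comp_ePow {p : Partition k l} {q : Partition l m} (hp : p.IsEven)
    (hq : q.IsEven) :
    (ePow k ≫ ofPartition p ≫ ePow l ≫ ofPartition q ≫ ePow m : (⟨k⟩ : ParZ2 t) ⟶ ⟨m⟩) =
      ((1 / 2 : ℂ) ^ l * Nat.card (Partition.middleSigns p q) * t ^ p.loops q) •
        (ePow k ≫ ofPartition (p.vcomp q) ≫ ePow m) := by
  classical
  have h : ∀ z : Fin l → ℤˣ,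
      ePow k ≫ ofPartition p ≫ (sgn z • ofTerm t (tokens z)) ≫ ofPartition q ≫ ePow m =
        if z ∈ Partition.middleSigns p q then
          t ^ p.loops q • (ePow k ≫ ofPartition (p.vcomp q) ≫ ePow m) else 0 := by
    intro z
    have h1 : ePow k ≫ ofPartition p ≫ (sgn z • ofTerm t (tokens z)) ≫ ofPartition q ≫ ePow m =
        sgn z • (ePow k ≫ ofTerm t (mulT (partT p) (mulT (tokens z) (partT q))) ≫ ePow m) := by
      simp only [← ofTerm_comp, ofTerm_partT, Category.assoc, Linear.smul_comp, Linear.comp_smul]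
    rw [h1]
    split_ifs with hz
    · exact ePow_partT_tokens_partT_ePow hp hq hz
    · rw [partT_tokens_partT_eq_none hz, ofTerm_none, Limits.zero_comp, Limits.comp_zero,
        smul_zero]
  rw [ePow_eq l, Linear.smul_comp, Linear.comp_smul, Linear.comp_smul, Preadditive.sum_comp,
    Preadditive.comp_sum, Preadditive.comp_sum, Finset.sum_congr rfl fun z _ => h z,
    Finset.sum_ite, Finset.sum_const, Finset.sum_const_zero, add_zero, ← Fintype.card_subtype,
    ← Nat.card_eq_fintype_card, ← Nat.cast_smul_eq_nsmul ℂ, smul_smul, smul_smul, mul_assoc]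

end ParZ2

/-! ### The embedding into the additive envelope is strict monoidal -/

namespace AddEnv

open MatAux MonoidalCategory

universe v u

variable {C : Type u} [Category.{v} C] [Preadditive C]

/-- With a single column and a constant family of targets, no transport along an equality of indices
remains in the entries. -/
theorem rel_apply_of_subsingleton {M : Mat_ C} {ι : Type} [Fintype ι] [Subsingleton ι] {Y : C}
    (e : M.ι → ι) (φ : ∀ i, M.X i ⟶ Y) (i j) : rel (N := ⟨ι, fun _ => Y⟩) e φ i j = φ i := by
  obtain rfl := Subsingleton.elim (e i) j
  exact rel_self _ _ _

variable [MonoidalCategory C]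

/-- The comparison isomorphisms `μ` only relabel rows and columns through `finProdFinEquiv`. -/
theorem kron_apply {M N M' N' : AddEnv C} (f : M ⟶ N) (g : M' ⟶ N') (i j) :
    kron f g i j = f (finProdFinEquiv.symm i).1 (finProdFinEquiv.symm j).1 ⊗ₘ
      g (finProdFinEquiv.symm i).2 (finProdFinEquiv.symm j).2 := by
  let h : M.mat ⊗ M'.mat ⟶ N.mat ⊗ N'.mat :=
    tens (M := M.mat) (N := N.mat) (M' := M'.mat) (N' := N'.mat) f g
  change ((μ M M').inv ≫ h ≫ (μ N N').hom) i j = h _ _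
  refine (rel_comp (M := (tensorObj M M').mat) (N := M.mat ⊗ M'.mat) finProdFinEquiv.symm
    (fun _ => 𝟙 _) (h ≫ (μ N N').hom) i j).trans ((Category.id_comp _).trans ?_)
  obtain ⟨q, rfl⟩ := finProdFinEquiv.surjective j
  refine (comp_rel (N := N.mat ⊗ N'.mat) (K := (tensorObj N N').mat) finProdFinEquiv _ h _ q).trans
    ?_
  -- The column index is generalised so that the transport disappears by substitution.
  have key : ∀ p q' (hq : q = q'),
      h p q ≫ eqToHom (congrArg (N.mat ⊗ N'.mat).X hq) ≫ 𝟙 _ = h p q' := by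
    rintro p _ rfl
    simp
  exact key _ _ (finProdFinEquiv.symm_apply_apply q).symm

variable [MonoidalPreadditive C]

/-- The length $1\cdot 1$ reduces to $1$, so the tensor product of two one-term sequences is
definitionally the one-term sequence of the tensor product, and both sides have the same type. -/
theorem ι_tensorHom {X Y X' Y' : C} (f : X ⟶ Y) (g : X' ⟶ Y') :
    (ι.map f ⊗ₘ ι.map g : ι.obj X ⊗ ι.obj X' ⟶ ι.obj Y ⊗ ι.obj Y') = ι.map (f ⊗ₘ g) := by
  funext i j
  exact kron_apply (ι.map f) (ι.map g) i j

theorem associator_hom (M N K : AddEnv C) :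
    (α_ M N K).hom = ((μ (tensorObj M N) K).inv ≫ ((μ M N).inv ⊗ₘ 𝟙 K.mat)) ≫
      (α_ M.mat N.mat K.mat).hom ≫
        ((𝟙 M.mat ⊗ₘ (μ N K).hom) ≫ (μ M (tensorObj N K)).hom) := rfl

/-- Every factor of the associator is a `rel` matrix, so the composite is one too. On one-term
sequences its only entry is the product of the entries, all identities except the associator of `C`.
The unitors are treated in the same way. -/
theorem ι_associator (X Y Z : C) :
    (α_ (ι.obj X) (ι.obj Y) (ι.obj Z)).hom = ι.map (α_ X Y Z).hom := by
  rw [associator_hom]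
  funext i j
  rw [id_eq_rel, id_eq_rel]
  let M : Mat_ C := (ι.obj X).mat
  let N : Mat_ C := (ι.obj Y).mat
  let K : Mat_ C := (ι.obj Z).mat
  let MN : Mat_ C := (tensorObj (ι.obj X) (ι.obj Y)).mat
  let NK : Mat_ C := (tensorObj (ι.obj Y) (ι.obj Z)).mat
  let L : Mat_ C := (tensorObj (tensorObj (ι.obj X) (ι.obj Y)) (ι.obj Z)).mat
  let R : Mat_ C := (tensorObj (ι.obj X) (tensorObj (ι.obj Y) (ι.obj Z))).mat
  change ((rel (M := L) (N := MN ⊗ K) _ _ ≫ (rel (M := MN) (N := M ⊗ N) _ _ ⊗ₘ rel _ _)) ≫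
    rel (M := (M ⊗ N) ⊗ K) (N := M ⊗ N ⊗ K) _ _ ≫
      ((rel _ _ ⊗ₘ rel (M := N ⊗ K) (N := NK) _ _) ≫ rel (M := M ⊗ NK) (N := R) _ _)) i j = _
  rw [rel_tens_rel, rel_tens_rel, rel_comp_rel, rel_comp_rel, rel_comp_rel, rel_comp_rel]
  -- The index type of the target appears in this unreduced form.
  have : Subsingleton (Fin (1 * (1 * 1))) := inferInstanceAs (Subsingleton (Fin 1))
  refine (rel_apply_of_subsingleton (M := L) (ι := Fin (1 * (1 * 1))) (Y := X ⊗ Y ⊗ Z) _ _ i j).trans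
    ?_
  change (𝟙 ((X ⊗ Y) ⊗ Z) ≫ (𝟙 (X ⊗ Y) ⊗ₘ 𝟙 Z)) ≫ (α_ X Y Z).hom ≫
    (𝟙 X ⊗ₘ eqToHom (rfl : Y ⊗ Z = Y ⊗ Z) ≫ 𝟙 (Y ⊗ Z)) ≫
      eqToHom (rfl : X ⊗ Y ⊗ Z = X ⊗ Y ⊗ Z) ≫ 𝟙 (X ⊗ Y ⊗ Z) = (α_ X Y Z).hom
  simp

theorem leftUnitor_hom (M : AddEnv C) :
    (λ_ M).hom = ((μ unit M).inv ≫ (ε.inv ⊗ₘ 𝟙 M.mat)) ≫ (λ_ M.mat).hom := rfl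

theorem rightUnitor_hom (M : AddEnv C) :
    (ρ_ M).hom = ((μ M unit).inv ≫ (𝟙 M.mat ⊗ₘ ε.inv)) ≫ (ρ_ M.mat).hom := rfl

theorem ι_leftUnitor (X : C) : (λ_ (ι.obj X)).hom = ι.map (λ_ X).hom := by
  rw [leftUnitor_hom]
  funext i j
  rw [id_eq_rel]
  let M : Mat_ C := (ι.obj X).mat
  let I : Mat_ C := (unit : AddEnv C).mat
  let L : Mat_ C := (tensorObj unit (ι.obj X)).mat
  change ((rel (M := L) (N := I ⊗ M) _ _ ≫ (rel (M := I) (N := 𝟙_ _) _ _ ⊗ₘ rel _ _)) ≫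
    rel (M := 𝟙_ _ ⊗ M) (N := M) _ _) i j = _
  rw [rel_tens_rel, rel_comp_rel, rel_comp_rel]
  refine (rel_apply_of_subsingleton (M := L) (ι := Fin 1) (Y := X) _ _ i j).trans ?_
  change (𝟙 (𝟙_ C ⊗ X) ≫ ((eqToHom (rfl : 𝟙_ C = 𝟙_ C) ≫ 𝟙 (𝟙_ C)) ⊗ₘ 𝟙 X)) ≫ (λ_ X).hom =
    (λ_ X).hom
  simp

theorem ι_rightUnitor (X : C) : (ρ_ (ι.obj X)).hom = ι.map (ρ_ X).hom := by
  rw [rightUnitor_hom]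
  funext i j
  rw [id_eq_rel]
  let M : Mat_ C := (ι.obj X).mat
  let I : Mat_ C := (unit : AddEnv C).mat
  let L : Mat_ C := (tensorObj (ι.obj X) unit).mat
  change ((rel (M := L) (N := M ⊗ I) _ _ ≫ (rel _ _ ⊗ₘ rel (M := I) (N := 𝟙_ _) _ _)) ≫
    rel (M := M ⊗ 𝟙_ _) (N := M) _ _) i j = _
  rw [rel_tens_rel, rel_comp_rel, rel_comp_rel]
  refine (rel_apply_of_subsingleton (M := L) (ι := Fin 1) (Y := X) _ _ i j).trans ?_
  change (𝟙 (X ⊗ 𝟙_ C) ≫ (𝟙 X ⊗ₘ (eqToHom (rfl : 𝟙_ C = 𝟙_ C) ≫ 𝟙 (𝟙_ C)))) ≫ (ρ_ X).hom =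
    (ρ_ X).hom
  simp

end AddEnv

/-! ### The functor on morphisms -/

open ParZ2 MonoidalCategory

namespace ParZ2

variable {t : ℂ}

/-- Induction on `l`, since `ePow` adds its factors on the right. The equalities $k+0=k$ and
$(k+l)+1=k+(l+1)$ hold definitionally, so the unitor and associator involved are identities. -/
theorem ePow_tensor_ePow (k l : ℕ) :
    (ePow k ⊗ₘ ePow l : (⟨k⟩ ⊗ ⟨l⟩ : ParZ2 t) ⟶ ⟨k⟩ ⊗ ⟨l⟩) = ePow (k + l) := by
  induction l with
  | zero =>
    have h := right_unit (ePow k : (⟨k⟩ : ParZ2 t) ⟶ ⟨k⟩)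
    rw [rightUnitor_def] at h
    exact ((Category.comp_id _).symm.trans h).trans (Category.id_comp _)
  | succ l ih =>
    have h := tensor_assoc (ePow k : (⟨k⟩ : ParZ2 t) ⟶ ⟨k⟩) (ePow l : (⟨l⟩ : ParZ2 t) ⟶ ⟨l⟩) e
    rw [associator_def, ih] at h
    exact ((Category.id_comp _).symm.trans h.symm).trans (Category.comp_id _)

end ParZ2

namespace RepZero

variable {t : ℂ} {k l m k' l' : ℕ}

/-- The linear extension of `p ↦ 2 ^ ((∑ mᵢ - 2 s) / 2) (e')^{⊗ l} ∘ p ∘ (e')^{⊗ k}`. -/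
noncomputable def omega (t : ℂ) :
    (EvenPart k l →₀ ℂ) →ₗ[ℂ] ((⟨k⟩ : ParZ2 (2 * t)) ⟶ ⟨l⟩) :=
  Finsupp.linearCombination ℂ fun p =>
    (p.part.coeff : ℂ) • (ePow k ≫ ParZ2.ofPartition p.part ≫ ePow l)

theorem omega_single (p : EvenPart k l) (a : ℂ) : omega t (Finsupp.single p a) =
    a • (p.part.coeff : ℂ) • (ePow k ≫ ParZ2.ofPartition p.part ≫ ePow l) := by
  simp [omega, Finsupp.linearCombination_single]

/-- Idempotency, extended linearly. With its counterpart on the other side, this makes the values of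
`omega` morphisms of the Karoubian envelope. -/
theorem ePow_comp_omega (f : EvenPart k l →₀ ℂ) : ePow k ≫ omega t f = omega t f := by
  induction f using Finsupp.induction_linear with
  | zero => rw [map_zero, Limits.comp_zero]
  | add f g hf hg => rw [map_add, Preadditive.comp_add, hf, hg]
  | single p a =>
    rw [omega_single, Linear.comp_smul, Linear.comp_smul, ← Category.assoc (ePow k), ePow_idem]

theorem omega_comp_ePow (f : EvenPart k l →₀ ℂ) : omega t f ≫ ePow l = omega t f := by
  induction f using Finsupp.induction_linear with
  | zero => rw [map_zero, Limits.zero_comp]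
  | add f g hf hg => rw [map_add, Preadditive.add_comp, hf, hg]
  | single p a =>
    rw [omega_single, Linear.smul_comp, Linear.smul_comp, Category.assoc, Category.assoc,
      ePow_idem]

/-- The identity partition has $n$ blocks of size $2$, so its coefficient is $1$; the identity of
the object in the Karoubian envelope is its idempotent. -/
theorem omega_one (n : ℕ) : omega t (EvenPart.oneL n) = ePow n := by
  have h : (ParZ2.ofPartition (Partition.idn n) : (⟨n⟩ : ParZ2 (2 * t)) ⟶ ⟨n⟩) = 𝟙 _ := rfl
  rw [EvenPart.oneL, omega_single, h, Category.id_comp, ePow_idem, Partition.coeff_idn, one_smul,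
    Complex.ofReal_one, one_smul]

/-- On basis elements this combines the averaging formula at parameter $2t$ with the count
`coeff_mul_coeff`. -/
theorem omega_comp (f : EvenPart k l →₀ ℂ) (g : EvenPart l m →₀ ℂ) :
    omega t (EvenPart.compL t f g) = omega t f ≫ omega t g := by
  induction f using Finsupp.induction_linear with
  | zero => rw [map_zero, LinearMap.zero_apply, map_zero, map_zero, Limits.zero_comp]
  | add f f' h1 h2 =>
    rw [map_add, LinearMap.add_apply, map_add, map_add, Preadditive.add_comp, h1, h2]
  | single p a =>
  induction g using Finsupp.induction_linear with
  | zero => rw [map_zero, map_zero, map_zero, Limits.comp_zero]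
  | add f f' h1 h2 => rw [map_add, map_add, map_add, Preadditive.comp_add, h1, h2]
  | single q b =>
    have h : EvenPart.compL t (Finsupp.single p a) (Finsupp.single q b) =
        (a * b) • EvenPart.compBasis t p q := by
      simp [EvenPart.compL, Finsupp.linearCombination_single, smul_smul]
    have h' : (ePow k ≫ ParZ2.ofPartition p.part ≫ ePow l) ≫
        (ePow l ≫ ParZ2.ofPartition q.part ≫ ePow m) =
        (ePow k ≫ ParZ2.ofPartition p.part ≫ ePow l ≫ ParZ2.ofPartition q.part ≫ ePow m :
          (⟨k⟩ : ParZ2 (2 * t)) ⟶ ⟨m⟩) := by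
      simp only [Category.assoc]
      rw [← Category.assoc (ePow l) (ePow l), ePow_idem]
    have hc := congrArg Complex.ofReal (p.part.coeff_mul_coeff q.part)
    push_cast at hc
    rw [h, map_smul, EvenPart.compBasis, omega_single, omega_single, omega_single]
    simp only [Linear.smul_comp, Linear.comp_smul]
    rw [h', ePow_comp_ePow_comp_ePow p.even q.even]
    simp only [smul_smul]
    congr 1
    -- The factor $2^{-l}$ from the middle idempotent meets the $2^l$ of `hc`; the latter has
    -- already used up the $2$ in $(2t)^{l(q,p)}$.
    have h2 : (1 / 2 : ℂ) ^ l * 2 ^ l = 1 := by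
      rw [← mul_pow, one_div, inv_mul_cancel₀ two_ne_zero, one_pow]
    rw [mul_pow]
    linear_combination (-(a * b * (1 / 2 : ℂ) ^ l * t ^ p.part.loops q.part)) * hc -
      (a * b * t ^ p.part.loops q.part * ((p.part.vcomp q.part).coeff : ℂ)) * h2

/-- By the interchange law, idempotents and partitions are concatenated separately, and the
coefficients multiply. -/
theorem omega_tensor (f : EvenPart k l →₀ ℂ) (g : EvenPart k' l' →₀ ℂ) :
    omega t (EvenPart.tensL f g) = omega t f ⊗ₘ omega t g := by
  induction f using Finsupp.induction_linear with
  | zero =>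
    rw [map_zero, LinearMap.zero_apply, map_zero, map_zero, MonoidalPreadditive.zero_tensor]
  | add f f' h1 h2 =>
    rw [map_add, LinearMap.add_apply, map_add, map_add, add_tensor', h1, h2]
  | single p a =>
  induction g using Finsupp.induction_linear with
  | zero =>
    rw [map_zero, map_zero, map_zero, MonoidalPreadditive.tensor_zero]
  | add f f' h1 h2 =>
    rw [map_add, map_add, map_add, tensor_add', h1, h2]
  | single q b =>
    have h : EvenPart.tensL (Finsupp.single p a) (Finsupp.single q b) =
        Finsupp.single ⟨p.part.tens q.part, p.even.tens q.even⟩ (a * b) := by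
      simp [EvenPart.tensL, Finsupp.linearCombination_single]
    rw [h, omega_single, omega_single, omega_single, smul_tensor', smul_tensor', tensor_smul',
      tensor_smul', ← tensorHom_comp_tensorHom, ← tensorHom_comp_tensorHom, ofPartition_tensor,
      ePow_tensor_ePow, ePow_tensor_ePow, Partition.coeff_tens, Complex.ofReal_mul]
    simp only [smul_smul]
    rw [show a * ((p.part.coeff : ℂ) * (b * (q.part.coeff : ℂ))) =
      a * b * ((p.part.coeff : ℂ) * (q.part.coeff : ℂ)) by ring]

/-- The functor `Ω₀`. -/
noncomputable def functor (t : ℂ) : RepZero t ⥤ Kar (ParZ2 (2 * t)) where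
  obj X := karObj (2 * t) X.n
  map {X Y} f :=
    { f := AddEnv.ι.map (omega t f)
      comm := by
        dsimp only [karObj]
        rw [← Functor.map_comp, ← Functor.map_comp, omega_comp_ePow, ePow_comp_omega] }
  map_id X := Idempotents.Karoubi.hom_ext _ _ (congrArg AddEnv.ι.map (omega_one X.n))
  map_comp f g := Idempotents.Karoubi.hom_ext _ _
    ((congrArg AddEnv.ι.map (omega_comp f g)).trans (AddEnv.ι.map_comp _ _))

instance : (functor t).Additive where
  map_add {_ _ f g} := Idempotents.Karoubi.hom_ext _ _
    (funext fun _ => funext fun _ => map_add (omega t) f g)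

instance : (functor t).Linear ℂ where
  map_smul f r := Idempotents.Karoubi.hom_ext _ _
    (funext fun _ => funext fun _ => map_smul (omega t) r f)

end RepZero

/-! ### Morphisms of the Karoubian envelope that come from `C` -/

namespace KaroubiAux

universe v u

variable {C : Type u} [Category.{v} C] [Preadditive C]

/-- The morphism `f` between objects `([X], p)` and `([Y], q)` is given by `f₀ : X ⟶ Y`. -/
def IsImage {P Q : Kar C} {X Y : C} (f : P ⟶ Q) (f₀ : X ⟶ Y) : Prop :=
  ∃ (hP : P.X = AddEnv.ι.obj X) (hQ : Q.X = AddEnv.ι.obj Y),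
    f.f = eqToHom hP ≫ AddEnv.ι.map f₀ ≫ eqToHom hQ.symm

namespace IsImage

variable {P Q R : Kar C} {X Y Z : C}

theorem comp {f : P ⟶ Q} {g : Q ⟶ R} {f₀ : X ⟶ Y} {g₀ : Y ⟶ Z} (hf : IsImage f f₀)
    (hg : IsImage g g₀) : IsImage (f ≫ g) (f₀ ≫ g₀) := by
  obtain ⟨hP, hQ, hf⟩ := hf
  obtain ⟨_, hR, hg⟩ := hg
  refine ⟨hP, hR, ?_⟩
  rw [Idempotents.Karoubi.comp_f, hf, hg, AddEnv.ι.map_comp]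
  simp

theorem congr {f : P ⟶ Q} {f₀ g₀ : X ⟶ Y} (hf : IsImage f f₀) (h : f₀ = g₀) : IsImage f g₀ :=
  h ▸ hf

/-- The transports depend only on the objects, by proof irrelevance. Coherence in the Karoubian
envelope can thus be checked on representatives in `C`. -/
theorem ext {f g : P ⟶ Q} {f₀ g₀ : X ⟶ Y} (hf : IsImage f f₀) (hg : IsImage g g₀)
    (h : f₀ = g₀) : f = g := by
  subst h
  obtain ⟨_, _, hf⟩ := hf
  obtain ⟨_, _, hg⟩ := hg
  exact Idempotents.Karoubi.hom_ext _ _ (hf.trans hg.symm)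

theorem of_eq {p q hp hq} {f : (⟨AddEnv.ι.obj X, p, hp⟩ : Kar C) ⟶ ⟨AddEnv.ι.obj Y, q, hq⟩}
    {f₀ : X ⟶ Y} (hf : f.f = AddEnv.ι.map f₀) : IsImage f f₀ :=
  ⟨rfl, rfl, by rw [hf, eqToHom_refl, eqToHom_refl, Category.id_comp, Category.comp_id]⟩

variable [MonoidalCategory C] [MonoidalPreadditive C]

theorem tensorHom {P' Q' : Kar C} {X' Y' : C} {f : P ⟶ Q} {g : P' ⟶ Q'} {f₀ : X ⟶ Y}
    {g₀ : X' ⟶ Y'} (hf : IsImage f f₀) (hg : IsImage g g₀) : IsImage (f ⊗ₘ g) (f₀ ⊗ₘ g₀) := by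
  obtain ⟨P, p, hp⟩ := P
  obtain ⟨Q, q, hq⟩ := Q
  obtain ⟨P', p', hp'⟩ := P'
  obtain ⟨Q', q', hq'⟩ := Q'
  obtain ⟨hP, hQ, hf⟩ := hf
  obtain ⟨hP', hQ', hg⟩ := hg
  dsimp only at hP hQ hP' hQ'
  -- Once the Karoubi objects are taken apart, their underlying objects are variables and the
  -- transports become trivial.
  subst hP hQ hP' hQ'
  refine ⟨rfl, rfl, ?_⟩
  rw [eqToHom_refl, eqToHom_refl, Category.id_comp, Category.comp_id] at hf hg
  refine Eq.trans ?_ ((Category.id_comp _).trans (Category.comp_id _)).symm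
  exact (congrArg₂ (fun a b => a ⊗ₘ b) hf hg).trans (AddEnv.ι_tensorHom f₀ g₀)

end IsImage

end KaroubiAux

/-! ### Structure morphisms at the objects $([\tilde k],(e')^{\otimes k})$ -/

namespace ParZ2

open KaroubiAux

variable {t : ℂ}

theorem isImage_id (k : ℕ) : IsImage (𝟙 (karObj t k)) (ePow k : (⟨k⟩ : ParZ2 t) ⟶ ⟨k⟩) :=
  .of_eq rfl

theorem unit_eq (t : ℂ) : 𝟙_ (Kar (ParZ2 t)) = karObj t 0 :=
  Idempotents.Karoubi.ext rfl
    ((Category.comp_id _).trans ((AddEnv.ι.map_id _).symm.trans (Category.id_comp _).symm))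

/-- The underlying objects agree definitionally; for the idempotents this is `ePow_tensor_ePow`,
transported along `AddEnv.ι`. -/
theorem tensor_eq (t : ℂ) (k l : ℕ) : karObj t k ⊗ karObj t l = karObj t (k + l) := by
  refine Idempotents.Karoubi.ext rfl ?_
  refine (Category.comp_id _).trans (Eq.trans ?_ (Category.id_comp _).symm)
  exact (AddEnv.ι_tensorHom (ePow k) (ePow l)).trans
    (congrArg AddEnv.ι.map (ePow_tensor_ePow k l))

/-- After substitution this is an identity, and the identity of an object $(X,p)$ of the Karoubian
envelope is $p$. -/
theorem isImage_eqToHom {P : Kar (ParZ2 t)} {k : ℕ} (h : P = karObj t k) :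
    IsImage (eqToHom h) (ePow k : (⟨k⟩ : ParZ2 t) ⟶ ⟨k⟩) := by
  subst h
  exact isImage_id k

/-- In the Karoubian envelope the associator is the idempotent followed by the underlying
associator, which on one-term sequences comes from $\mathrm{Par}(\mathbb Z_2,t)$ and is a transport
there. The unitors below follow the same pattern. -/
theorem isImage_associator (k l m : ℕ) :
    IsImage (α_ (karObj t k) (karObj t l) (karObj t m)).hom
      (ePow (k + l + m) ≫ eqToHom (congrArg mk (add_assoc k l m)) :
        (⟨k + l + m⟩ : ParZ2 t) ⟶ ⟨k + (l + m)⟩) := by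
  have h1 : (((karObj t k).p ⊗ₘ (karObj t l).p) ⊗ₘ (karObj t m).p) =
      AddEnv.ι.map (ePow (k + l + m) : (⟨k + l + m⟩ : ParZ2 t) ⟶ ⟨k + l + m⟩) := by
    refine Eq.trans (congrArg (· ⊗ₘ (karObj t m).p) ((AddEnv.ι_tensorHom (ePow k) (ePow l)).trans
      (congrArg AddEnv.ι.map (ePow_tensor_ePow k l)))) ?_
    exact (AddEnv.ι_tensorHom (ePow (k + l)) (ePow m)).trans
      (congrArg AddEnv.ι.map (ePow_tensor_ePow (k + l) m))
  refine ⟨rfl, rfl, Eq.trans ?_ ((Category.id_comp _).trans (Category.comp_id _)).symm⟩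
  exact (congrArg₂ (fun a b => a ≫ b) h1 (AddEnv.ι_associator _ _ _)).trans
    (AddEnv.ι.map_comp _ _).symm

theorem isImage_leftUnitor (k : ℕ) :
    IsImage (λ_ (karObj t k)).hom (ePow (0 + k) ≫ eqToHom (congrArg mk (zero_add k)) :
      (⟨0 + k⟩ : ParZ2 t) ⟶ ⟨k⟩) := by
  have h0 : (𝟙 (𝟙_ (AddEnv (ParZ2 t)))) = AddEnv.ι.map (𝟙 (𝟙_ (ParZ2 t))) :=
    (AddEnv.ι.map_id _).symm
  have h1 : 𝟙 (𝟙_ (AddEnv (ParZ2 t))) ⊗ₘ (karObj t k).p =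
      AddEnv.ι.map (ePow (0 + k) : (⟨0 + k⟩ : ParZ2 t) ⟶ ⟨0 + k⟩) :=
    (congrArg (· ⊗ₘ (karObj t k).p) h0).trans ((AddEnv.ι_tensorHom _ (ePow k)).trans
      (congrArg AddEnv.ι.map (ePow_tensor_ePow 0 k)))
  refine ⟨rfl, rfl, Eq.trans ?_ ((Category.id_comp _).trans (Category.comp_id _)).symm⟩
  exact (congrArg₂ (fun a b => a ≫ b) h1 (AddEnv.ι_leftUnitor _)).trans
    (AddEnv.ι.map_comp _ _).symm

theorem isImage_rightUnitor (k : ℕ) :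
    IsImage (ρ_ (karObj t k)).hom (ePow (k + 0) ≫ eqToHom (congrArg mk (add_zero k)) :
      (⟨k + 0⟩ : ParZ2 t) ⟶ ⟨k⟩) := by
  have h0 : (𝟙 (𝟙_ (AddEnv (ParZ2 t)))) = AddEnv.ι.map (𝟙 (𝟙_ (ParZ2 t))) :=
    (AddEnv.ι.map_id _).symm
  have h1 : (karObj t k).p ⊗ₘ 𝟙 (𝟙_ (AddEnv (ParZ2 t))) =
      AddEnv.ι.map (ePow (k + 0) : (⟨k + 0⟩ : ParZ2 t) ⟶ ⟨k + 0⟩) :=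
    (congrArg ((karObj t k).p ⊗ₘ ·) h0).trans ((AddEnv.ι_tensorHom (ePow k) _).trans
      (congrArg AddEnv.ι.map (ePow_tensor_ePow k 0)))
  refine ⟨rfl, rfl, Eq.trans ?_ ((Category.id_comp _).trans (Category.comp_id _)).symm⟩
  exact (congrArg₂ (fun a b => a ≫ b) h1 (AddEnv.ι_rightUnitor _)).trans
    (AddEnv.ι.map_comp _ _).symm

/-- Normal form for one side of the coherence conditions: substituting the equality removes the
transport, and idempotency merges the remaining factors. -/
theorem ePow_coherence {k l : ℕ} (h : k = l) :
    (ePow k ≫ ePow k ≫ eqToHom (congrArg mk h) ≫ ePow l : (⟨k⟩ : ParZ2 t) ⟶ ⟨l⟩) =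
      ePow k ≫ eqToHom (congrArg mk h) := by
  subst h
  simp [ePow_idem]

theorem ePow_coherence' {k l : ℕ} (h : k = l) :
    ((ePow k ≫ eqToHom (congrArg mk h)) ≫ ePow l ≫ ePow l : (⟨k⟩ : ParZ2 t) ⟶ ⟨l⟩) =
      ePow k ≫ eqToHom (congrArg mk h) := by
  subst h
  simp [ePow_idem]

end ParZ2

/-! ### The strict monoidal structure of the functor -/

namespace RepZero

open KaroubiAux

variable {t : ℂ}

theorem isImage_map {X Y : RepZero t} (f : X ⟶ Y) :
    IsImage ((functor t).map f) (omega t f : (⟨X.n⟩ : ParZ2 (2 * t)) ⟶ ⟨Y.n⟩) :=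
  .of_eq rfl

theorem isImage_map_eqToHom {k l : ℕ} (h : k = l) :
    IsImage ((functor t).map (eqToHom (congrArg mk h)))
      (eqToHom (congrArg ParZ2.mk h) ≫ ePow l : (⟨k⟩ : ParZ2 (2 * t)) ⟶ ⟨l⟩) := by
  subst h
  exact .of_eq (congrArg AddEnv.ι.map ((omega_one _).trans (Category.id_comp _).symm))

/-- Whiskering is tensoring with an identity, which is represented by the idempotent, that is, by
`omega` of the identity partition; so `omega_tensor` applies. -/
theorem isImage_whiskerRight {X Y : RepZero t} (f : X ⟶ Y) (Z : RepZero t) :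
    IsImage ((functor t).map f ▷ karObj (2 * t) Z.n)
      (omega t (f ▷ Z) : (⟨X.n + Z.n⟩ : ParZ2 (2 * t)) ⟶ ⟨Y.n + Z.n⟩) :=
  ((isImage_map f).tensorHom (isImage_id Z.n)).congr
    ((omega_tensor f (EvenPart.oneL Z.n)).trans (congrArg _ (omega_one Z.n))).symm

theorem isImage_whiskerLeft (Z : RepZero t) {X Y : RepZero t} (f : X ⟶ Y) :
    IsImage (karObj (2 * t) Z.n ◁ (functor t).map f)
      (omega t (Z ◁ f) : (⟨Z.n + X.n⟩ : ParZ2 (2 * t)) ⟶ ⟨Z.n + Y.n⟩) :=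
  ((isImage_id Z.n).tensorHom (isImage_map f)).congr
    ((omega_tensor (EvenPart.oneL Z.n) f).trans (congrArg (· ⊗ₘ _) (omega_one Z.n))).symm

/-- The structure morphisms of `Ω₀` are identities. -/
noncomputable def functorCoreMonoidal (t : ℂ) : (functor t).CoreMonoidal where
  εIso := eqToIso (unit_eq (2 * t))
  μIso X Y := eqToIso (tensor_eq (2 * t) X.n Y.n)
  μIso_hom_natural_left {X Y} f Z :=
    ((isImage_whiskerRight f Z).comp (isImage_eqToHom (tensor_eq _ _ _))).ext
      ((isImage_eqToHom (tensor_eq _ _ _)).comp (isImage_map (f ▷ Z)))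
      -- On representatives the structure morphisms are idempotents, and `omega` absorbs them on
      -- both sides.
      ((omega_comp_ePow (f ▷ Z)).trans (ePow_comp_omega (f ▷ Z)).symm)
  μIso_hom_natural_right {X Y} Z f :=
    ((isImage_whiskerLeft Z f).comp (isImage_eqToHom (tensor_eq _ _ _))).ext
      ((isImage_eqToHom (tensor_eq _ _ _)).comp (isImage_map (Z ◁ f)))
      ((omega_comp_ePow (Z ◁ f)).trans (ePow_comp_omega (Z ◁ f)).symm)
  associativity := by
    rintro ⟨k⟩ ⟨l⟩ ⟨m⟩
    have h1 : IsImage (eqToHom (tensor_eq (2 * t) k l) ▷ karObj (2 * t) m)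
        (ePow (k + l + m) : (⟨k + l + m⟩ : ParZ2 (2 * t)) ⟶ ⟨k + l + m⟩) :=
      ((isImage_eqToHom (tensor_eq _ k l)).tensorHom (isImage_id m)).congr
        (ePow_tensor_ePow (k + l) m)
    have h2 : IsImage (karObj (2 * t) k ◁ eqToHom (tensor_eq (2 * t) l m))
        (ePow (k + (l + m)) : (⟨k + (l + m)⟩ : ParZ2 (2 * t)) ⟶ ⟨k + (l + m)⟩) :=
      ((isImage_id k).tensorHom (isImage_eqToHom (tensor_eq _ l m))).congr
        (ePow_tensor_ePow k (l + m))
    refine (h1.comp ((isImage_eqToHom (tensor_eq _ _ _)).comp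
      (isImage_map_eqToHom (add_assoc k l m)))).ext ((isImage_associator k l m).comp
        (h2.comp (isImage_eqToHom (tensor_eq _ _ _)))) ?_
    -- Both paths reduce to the idempotent followed by the transport along associativity of
    -- addition.
    exact (ePow_coherence (add_assoc k l m)).trans (ePow_coherence' (add_assoc k l m)).symm
  left_unitality := by
    rintro ⟨k⟩
    have h1 : IsImage (eqToHom (unit_eq (2 * t)) ▷ karObj (2 * t) k)
        (ePow (0 + k) : (⟨0 + k⟩ : ParZ2 (2 * t)) ⟶ ⟨0 + k⟩) :=
      ((isImage_eqToHom (unit_eq _)).tensorHom (isImage_id k)).congr (ePow_tensor_ePow 0 k)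
    refine (isImage_leftUnitor k).ext (h1.comp ((isImage_eqToHom (tensor_eq _ 0 k)).comp
      (isImage_map_eqToHom (zero_add k)))) ?_
    exact (ePow_coherence (zero_add k)).symm
  right_unitality := by
    rintro ⟨k⟩
    have h1 : IsImage (karObj (2 * t) k ◁ eqToHom (unit_eq (2 * t)))
        (ePow (k + 0) : (⟨k + 0⟩ : ParZ2 (2 * t)) ⟶ ⟨k + 0⟩) :=
      ((isImage_id k).tensorHom (isImage_eqToHom (unit_eq _))).congr (ePow_tensor_ePow k 0)
    refine (isImage_rightUnitor k).ext (h1.comp ((isImage_eqToHom (tensor_eq _ k 0)).comp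
      (isImage_map_eqToHom (add_zero k)))) ?_
    exact (ePow_coherence (add_zero k)).symm

noncomputable instance : (functor t).Monoidal := (functorCoreMonoidal t).toMonoidal

theorem functor_isStrict (t : ℂ) : IsStrict (functor t) where
  unit := ⟨unit_eq (2 * t), rfl⟩
  tensor X Y := ⟨tensor_eq (2 * t) X.n Y.n, rfl⟩

theorem functor_map_ofEven {k l : ℕ} (f : EvenPart k l) :
    (functor t).map (ofEven f) =
      (f.part.coeff : ℂ) • karHom (ParZ2.ofPartition f.part) :=
  Idempotents.Karoubi.hom_ext _ _
    (congrArg AddEnv.ι.map ((omega_single f 1).trans (one_smul _ _)))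

end RepZero

end Interpolation

theorem mainTheorem6 (t : ℂ) :
    ∃ (Ω₀ : Interpolation.RepZero t ⥤ Interpolation.Kar (Interpolation.ParZ2 (2 * t)))
      (_ : Ω₀.Monoidal),
      Ω₀.Additive ∧ Ω₀.Linear ℂ ∧ Interpolation.IsStrict Ω₀ ∧
      ∃ hobj : ∀ k : ℕ, Ω₀.obj ⟨k⟩ = Interpolation.ParZ2.karObj (2 * t) k,
        ∀ (k l : ℕ) (f : Interpolation.EvenPart k l),
          Ω₀.map (Interpolation.RepZero.ofEven f) =
            eqToHom (hobj k) ≫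
              ((f.part.coeff : ℂ) •
                Interpolation.ParZ2.karHom (Interpolation.ParZ2.ofPartition f.part)) ≫
              eqToHom (hobj l).symm := by
  refine ⟨Interpolation.RepZero.functor t, inferInstance, inferInstance, inferInstance,
    Interpolation.RepZero.functor_isStrict t, fun _ => rfl, fun k l f => ?_⟩
  -- The object equalities hold by `rfl`, so both transports are identities.
  exact (Interpolation.RepZero.functor_map_ofEven f).trans
    ((Category.id_comp _).trans (Category.comp_id _)).symm
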